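/- **Definitions.** For a partially ordered set $P$ let $\mathrm{fs}(P)$ be the set of all final segments of $P$ (sets $F\subseteq P$ such that $x\in F$ and $x\le y$ imply $y\in F$), with the topology inherited from the Cantor cube $2^P$. Let $F(P)$ be the free Boolean algebra over $P$: a Boolean algebra with an order embedding $i_P:P\to F(P)$ such that every order preserving map $f$ from $P$ to a Boolean algebra $C$ is of the form $h\circ i_P$ for a unique homomorphism $h:F(P)\to C$. If $P=P_0\cup P_1$, where $P_0,P_1$ are chains well ordered by the order of $P$ (elements of $P_0$ and $P_1$ may be related to each other), then $\mathrm{fs}(P)$ is called a *nearly ordinal space* and $F(P)$ a *nearly ordinal Boolean algebra*. For a space $X$ let $X^{(0)}=X$, let $X^{(\alpha+1)}$ be the set of non-isolated points of $X^{(\alpha)}$, and let $X^{(\delta)}=\bigcap_{\xi<\delta}X^{(\xi)}$ for limit $\delta$. For a compact scattered space $X$, the Cantor–Bendixson rank $\mathrm{rk}(X)$ is the least $\alpha$ with $X^{(\alpha+1)}=\emptyset$; $X$ is *unitary* if $X^{(\mathrm{rk}(X))}$ has exactly one element, which is then called the end-point $e(X)$. Unitary spaces $X,Y$ are *almost homeomorphic*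 if there are clopen neighbourhoods $U$ of $e(X)$ in $X$ and $V$ of $e(Y)$ in $Y$ that are homeomorphic. A compact space $X$ is *retractive* if every nonempty closed subset of $X$ is a retract of $X$. The *Tikhonov plank* is $(\omega_1+1)\times(\omega+1)$, both factors with the order topology. For an uncountable cardinal $\kappa$ define an ordinal $r(\kappa)$ as follows. Let $E=\{\theta<\omega_2:\omega^\theta=\theta \text{ and } \mathrm{cf}(\theta)=\omega_1\}$, let $E_0$ be the initial segment of $E$ of order type $\omega_1$, and put $r(\aleph_1)=\sup(E_0)+\omega_1$. If $\kappa$ is a strong limit cardinal (that is, $2^\lambda<\kappa$ for all $\lambda<\kappa$), put $r(\kappa)=\kappa+\kappa$ (ordinal sum). In all other cases put $r(\kappa)=\kappa$. **Theorem 3.1.** Let $\kappa$ be an uncountable cardinal. There is a family $(P_\alpha)_{\alpha<2^\kappa}$ of partially ordered sets, each of which is the union of two well ordered chains, such that the nearly ordinal spaces $X_\alpha=\mathrm{fs}(P_\alpha)$ have the following properties. 1. Each $X_\alpha$ is a unitary compact scattered space, of cardinality $\kappa$ and of Cantor–Bendixson rank $r(\kappa)$. 2. For each $\alpha$, the space $X_\alpha$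 is not retractive; specifically, every neighbourhood of $e(X_\alpha)$ contains a homeomorphic copy of the Tikhonov plank. 3. If $\alpha\neq\beta$, then $X_\alpha$ and $X_\beta$ are not almost homeomorphic. Moreover, the nearly ordinal Boolean algebras $F(P_\alpha)$, $\alpha<2^\kappa$, have cardinality $\kappa$ and are pairwise non-isomorphic. In particular, for every uncountable cardinal $\kappa$ there exist $2^\kappa$ pairwise non-isomorphic nearly ordinal Boolean algebras of size $\kappa$. -/

import Mathlib

open Set Topology Cardinal Ordinal

universe u

namespace NearlyOrdinal

/-! ### Posets, final segments and free Boolean algebras -/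

/-- The space `fs(P)` of final segments of a poset `P`. -/
def FinalSegments (P : Type u) [PartialOrder P] : Type u :=
  {F : Set P // ∀ x y : P, x ∈ F → x ≤ y → y ∈ F}

open Classical in
/-- The characteristic function of a final segment, a point of the Cantor cube `2^P`. -/
noncomputable def FinalSegments.char {P : Type u} [PartialOrder P] (F : FinalSegments P) :
    P → Bool :=
  fun p => decide (p ∈ F.1)

/-- `fs(P)` carries the topology inherited from the Cantor cube `2^P`
(product topology, `Bool` discrete). -/
noncomputable instance FinalSegments.instTopologicalSpace {P : Type u} [PartialOrder P] : TopologicalSpace (FinalSegments P) :=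
  TopologicalSpace.induced FinalSegments.char inferInstance

/-- `P = P₀ ∪ P₁`, where `P₀` and `P₁` are chains of `P` that are well ordered by the
order of `P`. -/
def IsUnionOfTwoWellOrders (P : Type u) [PartialOrder P] : Prop :=
  ∃ P₀ P₁ : Set P, P₀ ∪ P₁ = Set.univ ∧
    (IsChain (· ≤ ·) P₀ ∧ P₀.IsWF) ∧ (IsChain (· ≤ ·) P₁ ∧ P₁.IsWF)

/-- `B`, together with the order embedding `i : P → B`, is the free Boolean algebra `F(P)`
over the poset `P`: every order preserving map from `P` to a Boolean algebra extends uniquely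
to a homomorphism of Boolean algebras. (Such a `B` lies in the universe of `P`, so that testing
against Boolean algebras of this universe determines `B` up to isomorphism.) -/
def IsFreeBooleanAlgebra {P : Type u} [PartialOrder P] {B : Type u} [BooleanAlgebra B]
    (i : P ↪o B) : Prop :=
  ∀ (C : Type u) [BooleanAlgebra C] (f : P →o C),
    ∃! h : BoundedLatticeHom B C, ∀ p : P, h (i p) = f p

/-! ### Cantor–Bendixson rank, unitary spaces, almost homeomorphic spaces -/

/-- The Cantor–Bendixson derivative `X^(α)`: `X^(0) = X`, `X^(α+1)` is the set of the
non-isolated points of `X^(α)`, and intersections are taken at limits. -/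
def cbDerivative (X : Type u) [TopologicalSpace X] (α : Ordinal.{u}) : Set X :=
  CantorBendixson.iteratedDerivedSet (Set.univ : Set X) α

/-- `X` is scattered: every nonempty subset has a relatively isolated point. -/
def IsScattered (X : Type u) [TopologicalSpace X] : Prop :=
  ∀ S : Set X, S.Nonempty → ∃ x ∈ S, x ∉ derivedSet S

/-- The Cantor–Bendixson rank of a (compact scattered) space: the first `α` such that
`X^(α+1)` is empty. -/
noncomputable def cbRank (X : Type u) [TopologicalSpace X] : Ordinal.{u} :=
  sInf {α : Ordinal.{u} | cbDerivative X (α + 1) = ∅}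

/-- `e` is the unique element of `X^(rk X)`. -/
def IsEndPoint {X : Type u} [TopologicalSpace X] (e : X) : Prop :=
  cbDerivative X (cbRank X) = {e}

/-- `X` is a unitary compact scattered space. -/
def IsUnitary (X : Type u) [TopologicalSpace X] : Prop :=
  CompactSpace X ∧ IsScattered X ∧ ∃ e : X, IsEndPoint e

/-- Unitary spaces `X` and `Y` are almost homeomorphic if their end-points have homeomorphic
clopen neighbourhoods. -/
def AlmostHomeomorphic (X Y : Type u) [TopologicalSpace X] [TopologicalSpace Y] : Prop :=
  ∃ (x : X) (y : Y), IsEndPoint x ∧ IsEndPoint y ∧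
    ∃ (U : Set X) (V : Set Y), IsClopen U ∧ IsClopen V ∧ x ∈ U ∧ y ∈ V ∧ Nonempty (U ≃ₜ V)

/-! ### Retractive spaces and the Tikhonov plank -/

/-- Every nonempty closed subset of `X` is a retract of `X`. -/
def IsRetractive (X : Type u) [TopologicalSpace X] : Prop :=
  ∀ Y : Set X, IsClosed Y → Y.Nonempty → ∃ f : C(X, Y), ∀ y : Y, f (y : X) = y

/-- The Tikhonov plank `(ω₁ + 1) × (ω + 1)`. -/
abbrev TikhonovPlank : Type 1 :=
  Set.Iic (ω₁ : Ordinal.{0}) × Set.Iic (ω : Ordinal.{0})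

/-- The set `U` contains a copy of the Tikhonov plank. -/
def ContainsTikhonovPlank {X : Type u} [TopologicalSpace X] (U : Set X) : Prop :=
  ∃ f : TikhonovPlank → X, IsEmbedding f ∧ range f ⊆ U

/-! ### The ordinals `r(κ)` -/

/-- `E = {θ < ω₂ : ω ^ θ = θ and cf θ = ω₁}`. -/
def setE : Set Ordinal.{u} :=
  {θ | θ < ω_ 2 ∧ ω ^ θ = θ ∧ θ.cof = ℵ₁}

/-- The initial segment `E₀` of `E` of order type `ω₁`: those `θ ∈ E` for which the set of the
smaller elements of `E` has order type less than `ω₁`. -/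
def setE₀ : Set Ordinal.{u} :=
  {θ | θ ∈ setE ∧ typeLT {η : Ordinal.{u} // η ∈ setE ∧ η < θ} < ω₁}

open Classical in
/-- The ordinal `r(κ)`, for uncountable `κ`: `r(ℵ₁) = sup E₀ + ω₁`, `r(κ) = κ + κ` if `κ` is a
strong limit cardinal, and `r(κ) = κ` for every other `κ`. -/
noncomputable def rOrd (κ : Cardinal.{u}) : Ordinal.{u} :=
  if κ = ℵ₁ then sSup setE₀ + ω₁
  else if IsStrongLimit κ then κ.ord + κ.ord
  else κ.ord

end NearlyOrdinal

open NearlyOrdinal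

/-! Let `r = rOrd κ`, and let `P` be the lexicographic sum over `ω ^ r` of disjoint sums `ω₁ ⊔ ω` at
the places `d ∈ D` and of single points elsewhere. A final segment of `P` is a cut between places or
a pair `(α, n)` at some `d ∈ D`. So `fs(P)` is the ordinal `ω ^ r + 1` with a Tikhonov plank
inserted between `d` and `d + 1` for each `d ∈ D`, its corner `(ω₁, ω)` being the cut at `d + 1`
(`eq_cut_or_eq_pt`, `pt_omega`). The rank of the cut at `e ≠ 0` lies between `lastExp e`, its rank
in the ordinal, and `ω₁ + 1 + lastExp e`. The two agree once `lastExp e ≥ ω₁ * ω`, so the space is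
unitary of rank `r` with the cut at `ω ^ r` as end-point.

The points all of whose neighbourhoods contain a plank are the limits and the members of the set of
cuts at `d + 1`, `d ∈ D` (`plankPoints_eq`): any other point has a neighbourhood that is countable
or a chain, and neither can contain a plank. Now let `D` consist of the clusters `ω ^ a + ω ^ g a *
n`, with `a ∈ A` and `g a < a`. The limits, but not limits of limits, of the plank points are
exactly the cuts at `ω ^ a + ω ^ (g a + 1)`, of rank `g a + 1`. The set of these ranks inside an
open set is a topological invariant (`plankLimitRanks_congr`). For each `T ⊆ κ` the set `A` is
chosen so that `g` takes on `A` only codes of members of `T` and one spare code, each of them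
cofinally in `r` (`exists_coding`). Then every neighbourhood of the end-point determines `T`.

The plank has no retraction onto the union of its top and right edges, so these spaces are not
retractive. The algebra `F(P)` is realised by sets of final segments, and an isomorphism of such
algebras induces a homeomorphism of the spaces. -/

namespace NearlyOrdinal

/-! ### The compact space of final segments -/

namespace FinalSegments

variable {P : Type u} [PartialOrder P]

theorem ext_iff {F G : FinalSegments P} : F = G ↔ ∀ p, p ∈ F.1 ↔ p ∈ G.1 := by
  exact (Subtype.ext_iff).trans Set.ext_iff

theorem char_apply (F : FinalSegments P) (p : P) : F.char p = true ↔ p ∈ F.1 := by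
  simp [char]

theorem continuous_char : Continuous (char : FinalSegments P → P → Bool) :=
  continuous_induced_dom

theorem isClopen_mem (p : P) : IsClopen {F : FinalSegments P | p ∈ F.1} := by
  have : {F : FinalSegments P | p ∈ F.1} = (fun F => F.char p) ⁻¹' {true} := by
    ext F; simp [char]
  rw [this]
  exact (isClopen_discrete _).preimage ((continuous_apply p).comp continuous_char)

theorem continuous_of_isClopen {Z : Type*} [TopologicalSpace Z] {f : Z → FinalSegments P}
    (h : ∀ p, IsClopen {z | p ∈ (f z).1}) : Continuous f := by
  refine continuous_induced_rng.2 (continuous_pi fun p => ?_)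
  rw [continuous_discrete_rng]
  intro b
  cases b
  · convert (h p).compl.isOpen using 1
    ext z; simp [char]
  · convert (h p).isOpen using 1
    ext z; simp [char]

theorem char_injective : Function.Injective (char : FinalSegments P → P → Bool) := by
  intro F G h
  refine ext_iff.2 fun p => ?_
  rw [← char_apply, ← char_apply, h]

instance : T2Space (FinalSegments P) :=
  T2Space.of_injective_continuous char_injective continuous_char

instance : CompactSpace (FinalSegments P) := by
  have hr : range (char : FinalSegments P → P → Bool) =
      ⋂ (x : P) (y : P) (_ : x ≤ y), {c | c x = true → c y = true} := by
    ext c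
    simp only [mem_range, mem_iInter, mem_ofPred_eq]
    constructor
    · rintro ⟨F, rfl⟩ x y hxy
      simpa [char] using fun h => F.2 x y h hxy
    · intro h
      refine ⟨⟨{p | c p = true}, fun x y hx hxy => h x y hxy hx⟩, ?_⟩
      ext p
      simp [char]
  have hc : IsClosedEmbedding (char : FinalSegments P → P → Bool) := by
    refine ⟨⟨⟨rfl⟩, char_injective⟩, ?_⟩
    rw [hr]
    refine isClosed_iInter fun x => isClosed_iInter fun y => isClosed_iInter fun _ => ?_
    have : {c : P → Bool | c x = true → c y = true} =
        ((fun c : P → Bool => (c x, c y)) ⁻¹' {b | b.1 = true → b.2 = true}) := rfl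
    rw [this]
    exact (isClosed_discrete _).preimage ((continuous_apply x).prodMk (continuous_apply y))
  exact hc.compactSpace

/-- The principal final segment of an element. -/
def principal (p : P) : FinalSegments P := ⟨Ici p, fun _ _ hx hxy => le_trans hx hxy⟩

theorem principal_injective : Function.Injective (principal : P → FinalSegments P) := by
  intro p q h
  have := congrArg Subtype.val h
  exact Ici_injective this

/-- The trace of `F` on each of the two chains is empty or has a least element, so at most two
elements generate `F`. Hence the supersets of `F` form a clopen set, and there are no more final
segments than finite subsets of `P`. -/
theorem exists_finset (hP : IsUnionOfTwoWellOrders P) (F : FinalSegments P) :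
    ∃ s : Finset P, ∀ p, p ∈ F.1 ↔ ∃ q ∈ s, q ≤ p := by
  classical
  obtain ⟨P₀, P₁, hU, ⟨hc₀, hw₀⟩, ⟨hc₁, hw₁⟩⟩ := hP
  have key : ∀ Q : Set P, IsChain (· ≤ ·) Q → Q.IsWF →
      ∃ s : Finset P, (∀ q ∈ s, q ∈ F.1) ∧ ∀ p ∈ F.1 ∩ Q, ∃ q ∈ s, q ≤ p := by
    intro Q hc hw
    rcases (F.1 ∩ Q).eq_empty_or_nonempty with h | h
    · exact ⟨∅, by simp, by simp [h]⟩
    · have hw' : (F.1 ∩ Q).IsWF := hw.mono inter_subset_right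
      refine ⟨{hw'.min h}, by simpa using (hw'.min_mem h).1, fun p hp => ⟨hw'.min h, by simp, ?_⟩⟩
      rcases hc.total (hw'.min_mem h).2 hp.2 with h' | h'
      · exact h'
      · by_contra hne
        exact hw'.not_lt_min h hp (lt_of_le_not_ge h' hne)
  obtain ⟨s, hs, hs'⟩ := key P₀ hc₀ hw₀
  obtain ⟨t, ht, ht'⟩ := key P₁ hc₁ hw₁
  refine ⟨s ∪ t, fun p => ⟨fun hp => ?_, ?_⟩⟩
  · have : p ∈ P₀ ∪ P₁ := by rw [hU]; trivial
    rcases this with h | h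
    · obtain ⟨q, hq, hqp⟩ := hs' p ⟨hp, h⟩
      exact ⟨q, by simp [hq], hqp⟩
    · obtain ⟨q, hq, hqp⟩ := ht' p ⟨hp, h⟩
      exact ⟨q, by simp [hq], hqp⟩
  · rintro ⟨q, hq, hqp⟩
    refine F.2 q p ?_ hqp
    rcases Finset.mem_union.1 hq with h | h
    · exact hs q h
    · exact ht q h

theorem isClopen_superset (hP : IsUnionOfTwoWellOrders P) (F : FinalSegments P) :
    IsClopen {G : FinalSegments P | F.1 ⊆ G.1} := by
  obtain ⟨s, hs⟩ := exists_finset hP F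
  have : {G : FinalSegments P | F.1 ⊆ G.1} = ⋂ q ∈ s, {G : FinalSegments P | q ∈ G.1} := by
    ext G
    simp only [mem_ofPred_eq, mem_iInter]
    constructor
    · exact fun h q hq => h ((hs q).2 ⟨q, hq, le_rfl⟩)
    · intro h p hp
      obtain ⟨q, hq, hqp⟩ := (hs p).1 hp
      exact G.2 q p (h q hq) hqp
  rw [this]
  exact s.finite_toSet.isClopen_biInter fun q _ => isClopen_mem q

theorem mk_eq [Infinite P] (hP : IsUnionOfTwoWellOrders P) : #(FinalSegments P) = #P := by
  refine le_antisymm ?_ (mk_le_of_injective principal_injective)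
  choose s hs using exists_finset hP
  rw [← mk_finset_of_infinite P]
  refine mk_le_of_injective (f := s) fun F G h => ext_iff.2 fun p => ?_
  rw [hs, hs, h]

end FinalSegments

/-! ### The free Boolean algebra over a poset -/

section Free

variable (P : Type u) [PartialOrder P]

/-- The algebra of sets of final segments generated by the sets `{F | p ∈ F}`. -/
abbrev freeAlg : BooleanSubalgebra (Set (FinalSegments P)) :=
  BooleanSubalgebra.closure (range fun p : P => {F : FinalSegments P | p ∈ F.1})

/-- The canonical embedding of a poset into the free Boolean algebra over it. -/
def freeAlg.of : P ↪o freeAlg P where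
  toFun p := ⟨{F | p ∈ F.1}, BooleanSubalgebra.subset_closure ⟨p, rfl⟩⟩
  inj' p q h := by
    have h' : {F : FinalSegments P | p ∈ F.1} = {F | q ∈ F.1} := congrArg Subtype.val h
    have h₁ : q ∈ (FinalSegments.principal p).1 := by
      have : FinalSegments.principal p ∈ {F : FinalSegments P | p ∈ F.1} := le_refl p
      rw [h'] at this
      exact this
    have h₂ : p ∈ (FinalSegments.principal q).1 := by
      have : FinalSegments.principal q ∈ {F : FinalSegments P | q ∈ F.1} := le_refl q
      rw [← h'] at this
      exact this
    exact le_antisymm h₁ h₂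
  map_rel_iff' := by
    intro p q
    constructor
    · intro h
      exact h (show FinalSegments.principal p ∈ {F : FinalSegments P | p ∈ F.1} from le_refl p)
    · intro h F hF
      exact F.2 p q hF h

variable {P}

theorem freeAlg.mem_of {p : P} {F : FinalSegments P} :
    F ∈ (freeAlg.of P p : Set (FinalSegments P)) ↔ p ∈ F.1 := Iff.rfl

theorem freeAlg.induction {p : freeAlg P → Prop} (of : ∀ x, p (freeAlg.of P x)) (bot : p ⊥)
    (sup : ∀ a b, p a → p b → p (a ⊔ b)) (compl : ∀ a, p a → p aᶜ) (b : freeAlg P) : p b := by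
  obtain ⟨b, hb⟩ := b
  refine BooleanSubalgebra.closure_bot_sup_induction (p := fun g hg => p ⟨g, hg⟩)
    ?_ bot ?_ ?_ hb
  · rintro _ ⟨x, rfl⟩
    exact of x
  · exact fun x hx y hy h h' => sup ⟨x, hx⟩ ⟨y, hy⟩ h h'
  · exact fun x hx h => compl ⟨x, hx⟩ h

/-- In a Boolean algebra nonzero elements are separated from `⊥` by prime ideals. -/
theorem exists_prime_ideal_notMem {C : Type*} [BooleanAlgebra C] {c : C} (hc : c ≠ ⊥) :
    ∃ J : Order.Ideal C, J.IsPrime ∧ c ∉ J := by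
  have hd : Disjoint ((Order.PFilter.principal c : Order.PFilter C) : Set C)
      ((⊥ : Order.Ideal C) : Set C) := by
    rw [Set.disjoint_left]
    intro x hx hx'
    have hx1 : c ≤ x := hx
    have hx2 : x = ⊥ := le_bot_iff.1 hx'
    exact hc (le_bot_iff.1 (hx2 ▸ hx1))
  obtain ⟨J, hJ, -, hdis⟩ := DistribLattice.prime_ideal_of_disjoint_filter_ideal hd
  exact ⟨J, hJ, fun h => Set.disjoint_left.1 hdis (show c ≤ c from le_rfl) h⟩

/-- The relation between `freeAlg P` and `C` generated by the graph of `f`. -/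
def freeGraph {C : Type*} [BooleanAlgebra C] (f : P →o C) :
    BooleanSubalgebra (freeAlg P × C) :=
  BooleanSubalgebra.closure (range fun p : P => (freeAlg.of P p, f p))

/-- A prime ideal `J` that misses `c` yields the final segment `F = {p | f p ∉ J}`. Membership of
`F` in the first coordinate matches avoidance of `J` by the second, on the generators and hence on
the whole graph; but `F ∉ ⊥`. -/
theorem freeGraph_eq_bot {C : Type*} [BooleanAlgebra C] (f : P →o C) {c : C}
    (h : ((⊥ : freeAlg P), c) ∈ freeGraph f) : c = ⊥ := by
  by_contra hc
  obtain ⟨J, hJ, hcJ⟩ := exists_prime_ideal_notMem hc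
  let F : FinalSegments P := ⟨{p | f p ∉ J}, fun x y hx hxy hy => hx (J.lower (f.2 hxy) hy)⟩
  have key : ∀ z ∈ freeGraph f, F ∈ (z.1 : Set (FinalSegments P)) ↔ z.2 ∉ J := by
    intro z hz
    refine BooleanSubalgebra.closure_bot_sup_induction
      (p := fun z _ => F ∈ (z.1 : Set (FinalSegments P)) ↔ z.2 ∉ J) ?_ ?_ ?_ ?_ hz
    · rintro _ ⟨p, rfl⟩
      exact Iff.rfl
    · simp
    · intro x _ y _ hx hy
      have : F ∈ ((x ⊔ y).1 : Set (FinalSegments P)) ↔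
          F ∈ (x.1 : Set (FinalSegments P)) ∨ F ∈ (y.1 : Set (FinalSegments P)) := Iff.rfl
      rw [this, hx, hy, Prod.snd_sup, Order.Ideal.sup_mem_iff]
      tauto
    · intro x _ hx
      have : F ∈ ((xᶜ).1 : Set (FinalSegments P)) ↔
          ¬ F ∈ (x.1 : Set (FinalSegments P)) := Iff.rfl
      rw [this, hx, not_not, show (xᶜ).2 = x.2ᶜ from rfl]
      constructor
      · intro h1 h2
        exact hJ.top_notMem (by simpa using J.sup_mem h1 h2)
      · intro h1
        exact hJ.mem_or_compl_mem.resolve_right h1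
  exact ((key _ h).2 hcJ).elim

theorem freeGraph_unique {C : Type*} [BooleanAlgebra C] (f : P →o C) {b : freeAlg P} {c c' : C}
    (h : (b, c) ∈ freeGraph f) (h' : (b, c') ∈ freeGraph f) : c = c' := by
  have h1 := freeGraph_eq_bot f (c := c \ c') (by
    have := BooleanSubalgebra.sdiff_mem h h'
    rw [← sdiff_self (a := b)]
    exact this)
  have h2 := freeGraph_eq_bot f (c := c' \ c) (by
    have := BooleanSubalgebra.sdiff_mem h' h
    rw [← sdiff_self (a := b)]
    exact this)
  exact le_antisymm (sdiff_eq_bot_iff.1 h1) (sdiff_eq_bot_iff.1 h2)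

theorem exists_mem_freeGraph {C : Type*} [BooleanAlgebra C] (f : P →o C) (b : freeAlg P) :
    ∃ c, (b, c) ∈ freeGraph f := by
  refine freeAlg.induction (p := fun b => ∃ c, (b, c) ∈ freeGraph f) ?_ ?_ ?_ ?_ b
  · exact fun x => ⟨f x, BooleanSubalgebra.subset_closure ⟨x, rfl⟩⟩
  · exact ⟨⊥, BooleanSubalgebra.bot_mem⟩
  · rintro a b ⟨c, hc⟩ ⟨d, hd⟩
    exact ⟨c ⊔ d, BooleanSubalgebra.sup_mem hc hd⟩
  · rintro a ⟨c, hc⟩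
    exact ⟨cᶜ, BooleanSubalgebra.compl_mem hc⟩

/-- The relation generated by the graph of `f` is total and single-valued; being a subalgebra of the
product, it is the graph of a homomorphism. -/
theorem isFreeBooleanAlgebra_of : IsFreeBooleanAlgebra (freeAlg.of P) := by
  intro C _ f
  choose h hh using exists_mem_freeGraph f
  refine ⟨{ toFun := h, map_sup' := ?_, map_inf' := ?_, map_top' := ?_, map_bot' := ?_ }, ?_, ?_⟩
  · exact fun a b => freeGraph_unique f (hh _) (BooleanSubalgebra.sup_mem (hh a) (hh b))
  · exact fun a b => freeGraph_unique f (hh _) (BooleanSubalgebra.inf_mem (hh a) (hh b))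
  · exact freeGraph_unique f (hh _) BooleanSubalgebra.top_mem
  · exact freeGraph_unique f (hh _) BooleanSubalgebra.bot_mem
  · exact fun p => freeGraph_unique f (hh _) (BooleanSubalgebra.subset_closure ⟨p, rfl⟩)
  · intro g hg
    refine DFunLike.ext _ _ fun b => ?_
    refine freeGraph_unique f (b := b) ?_ (hh b)
    refine freeAlg.induction (p := fun b => (b, g b) ∈ freeGraph f) ?_ ?_ ?_ ?_ b
    · intro x
      rw [hg]
      exact BooleanSubalgebra.subset_closure ⟨x, rfl⟩
    · rw [map_bot]
      exact BooleanSubalgebra.bot_mem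
    · intro a b ha hb
      rw [map_sup]
      exact BooleanSubalgebra.sup_mem ha hb
    · intro a ha
      rw [map_compl']
      exact BooleanSubalgebra.compl_mem ha

-- An element of the algebra depends on finitely many coordinates: it is coded by a finite set `s`
-- together with the traces on `s` that belong to it.
open Classical in
theorem mk_freeAlg [Infinite P] : #(freeAlg P) = #P := by
  refine le_antisymm ?_ (mk_le_of_injective (freeAlg.of P).injective)
  have key : ∀ b : freeAlg P, ∃ z : Finset P × Finset (Finset P),
      ∀ F : FinalSegments P, F ∈ (b : Set (FinalSegments P)) ↔ z.1.filter (· ∈ F.1) ∈ z.2 := by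
    refine freeAlg.induction ?_ ?_ ?_ ?_
    · intro x
      refine ⟨({x}, {{x}}), fun F => ?_⟩
      rw [freeAlg.mem_of]
      by_cases hx : x ∈ F.1 <;> simp [Finset.filter_singleton, hx]
    · exact ⟨(∅, ∅), fun F => by simp⟩
    · rintro a b ⟨⟨s, A⟩, hA⟩ ⟨⟨t, B⟩, hB⟩
      refine ⟨(s ∪ t, (s ∪ t).powerset.filter fun w => w ∩ s ∈ A ∨ w ∩ t ∈ B), fun F => ?_⟩
      have h1 : (s ∪ t).filter (· ∈ F.1) ∩ s = s.filter (· ∈ F.1) := by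
        ext p; simp only [Finset.mem_inter, Finset.mem_filter, Finset.mem_union]; tauto
      have h2 : (s ∪ t).filter (· ∈ F.1) ∩ t = t.filter (· ∈ F.1) := by
        ext p; simp only [Finset.mem_inter, Finset.mem_filter, Finset.mem_union]; tauto
      have : F ∈ ((a ⊔ b : freeAlg P) : Set (FinalSegments P)) ↔
          F ∈ (a : Set (FinalSegments P)) ∨ F ∈ (b : Set (FinalSegments P)) := Iff.rfl
      rw [this, hA, hB, Finset.mem_filter, h1, h2]
      simp only [Finset.mem_powerset, Finset.filter_subset, true_and]
    · rintro a ⟨⟨s, A⟩, hA⟩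
      refine ⟨(s, s.powerset \ A), fun F => ?_⟩
      have : F ∈ ((aᶜ : freeAlg P) : Set (FinalSegments P)) ↔
          ¬ F ∈ (a : Set (FinalSegments P)) := Iff.rfl
      rw [this, hA, Finset.mem_sdiff]
      simp only [Finset.mem_powerset, Finset.filter_subset, true_and]
  choose z hz using key
  have hle : #(freeAlg P) ≤ #(Finset P × Finset (Finset P)) := by
    refine mk_le_of_injective (f := z) fun a b h => Subtype.ext (Set.ext fun F => ?_)
    rw [hz, hz, h]
  refine hle.trans (le_of_eq ?_)
  rw [mk_prod, Cardinal.lift_id, Cardinal.lift_id, mk_finset_of_infinite, mk_finset_of_infinite,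
    mk_finset_of_infinite, mul_eq_self (aleph0_le_mk P)]

theorem isClopen_of_mem_freeAlg (b : freeAlg P) : IsClopen (b : Set (FinalSegments P)) := by
  refine freeAlg.induction (p := fun b => IsClopen (b : Set (FinalSegments P))) ?_ ?_ ?_ ?_ b
  · exact FinalSegments.isClopen_mem
  · exact isClopen_empty
  · exact fun a b ha hb => ha.union hb
  · exact fun a ha => ha.compl

/-- The map on final segments induced by an isomorphism of free Boolean algebras. -/
def freeAlg.mapIso {Q : Type u} [PartialOrder Q] (e : freeAlg P ≃o freeAlg Q)
    (F : FinalSegments P) : FinalSegments Q :=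
  ⟨{q | F ∈ (e.symm (freeAlg.of Q q) : Set (FinalSegments P))}, fun _ _ hx hxy =>
    (e.symm.monotone ((freeAlg.of Q).monotone hxy) :
      (e.symm (freeAlg.of Q _) : Set (FinalSegments P)) ⊆ _) hx⟩

/-- True by definition on generators and preserved by the Boolean operations: `mapIso` is the Stone
dual of `e`. -/
theorem freeAlg.mem_mapIso {Q : Type u} [PartialOrder Q] (e : freeAlg P ≃o freeAlg Q)
    (F : FinalSegments P) (b : freeAlg Q) :
    freeAlg.mapIso e F ∈ (b : Set (FinalSegments Q)) ↔
      F ∈ (e.symm b : Set (FinalSegments P)) := by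
  refine freeAlg.induction (p := fun b => freeAlg.mapIso e F ∈ (b : Set (FinalSegments Q)) ↔
      F ∈ (e.symm b : Set (FinalSegments P))) ?_ ?_ ?_ ?_ b
  · exact fun x => Iff.rfl
  · rw [map_bot]; exact Iff.rfl
  · intro a b ha hb
    rw [map_sup]
    exact or_congr ha hb
  · intro a ha
    rw [map_compl']
    exact not_congr ha

theorem freeAlg.mapIso_symm_mapIso {Q : Type u} [PartialOrder Q] (e : freeAlg P ≃o freeAlg Q)
    (F : FinalSegments P) : freeAlg.mapIso e.symm (freeAlg.mapIso e F) = F := by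
  refine FinalSegments.ext_iff.2 fun p => ?_
  change freeAlg.mapIso e F ∈ (e (freeAlg.of P p) : Set (FinalSegments Q)) ↔ _
  rw [freeAlg.mem_mapIso, e.symm_apply_apply]
  exact Iff.rfl

/-- Isomorphic free Boolean algebras have homeomorphic spaces of final segments. -/
def freeAlg.homeomorph {Q : Type u} [PartialOrder Q] (e : freeAlg P ≃o freeAlg Q) :
    FinalSegments P ≃ₜ FinalSegments Q where
  toFun := freeAlg.mapIso e
  invFun := freeAlg.mapIso e.symm
  left_inv := freeAlg.mapIso_symm_mapIso e
  right_inv := freeAlg.mapIso_symm_mapIso e.symm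
  continuous_toFun := FinalSegments.continuous_of_isClopen fun _ => isClopen_of_mem_freeAlg _
  continuous_invFun := FinalSegments.continuous_of_isClopen fun _ => isClopen_of_mem_freeAlg _

end Free

/-! ### Cantor–Bendixson derivatives -/

section CantorBendixson

variable {X Z : Type u} [TopologicalSpace X] [TopologicalSpace Z]

theorem cbDerivative_zero : cbDerivative X 0 = Set.univ := CantorBendixson.iteratedDerivedSet_zero

theorem mem_cbDerivative_add_one {x : X} {α : Ordinal.{u}} :
    x ∈ cbDerivative X (α + 1) ↔ x ∈ derivedSet (cbDerivative X α) ∧ x ∈ cbDerivative X α := by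
  rw [cbDerivative, CantorBendixson.iteratedDerivedSet_succ]
  exact Iff.rfl

theorem mem_cbDerivative_limit {x : X} {α : Ordinal.{u}} (hα : Order.IsSuccLimit α) :
    x ∈ cbDerivative X α ↔ ∀ β < α, x ∈ cbDerivative X β := by
  rw [cbDerivative, CantorBendixson.iteratedDerivedSet_limit hα]
  simp [cbDerivative]

theorem cbDerivative_antitone : Antitone (cbDerivative X) :=
  CantorBendixson.iteratedDerivedSet_antitone _

theorem mem_derivedSet_iff {A : Set X} {x : X} :
    x ∈ derivedSet A ↔ ∀ U ∈ 𝓝 x, ∃ y ∈ U ∩ A, y ≠ x := accPt_iff_nhds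

theorem preimage_derivedSet {j : Z → X} (hj : IsOpenEmbedding j) (A : Set X) :
    j ⁻¹' derivedSet A = derivedSet (j ⁻¹' A) := by
  ext z
  simp only [mem_preimage, mem_derivedSet_iff]
  constructor
  · intro h U hU
    obtain ⟨_, ⟨⟨y, hy, rfl⟩, hyA⟩, hne⟩ := h (j '' U) (hj.isOpenMap.image_mem_nhds hU)
    exact ⟨y, ⟨hy, hyA⟩, fun h => hne (h ▸ rfl)⟩
  · intro h U hU
    obtain ⟨y, ⟨hyU, hyA⟩, hne⟩ := h (j ⁻¹' U) (hj.continuous.continuousAt hU)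
    exact ⟨j y, ⟨hyU, hyA⟩, fun h => hne (hj.injective h)⟩

theorem preimage_cbDerivative {j : Z → X} (hj : IsOpenEmbedding j) (α : Ordinal.{u}) :
    j ⁻¹' cbDerivative X α = cbDerivative Z α := by
  induction α using Ordinal.limitRecOn with
  | zero => simp [cbDerivative_zero]
  | add_one α ih =>
    ext z
    rw [mem_preimage, mem_cbDerivative_add_one, mem_cbDerivative_add_one, ← ih,
      ← preimage_derivedSet hj]
    exact Iff.rfl
  | limit α hα ih =>
    ext z
    rw [mem_preimage, mem_cbDerivative_limit hα, mem_cbDerivative_limit hα]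
    exact forall₂_congr fun β hβ => by rw [← ih β hβ]; exact Iff.rfl

theorem cbRank_congr (e : X ≃ₜ Z) : cbRank X = cbRank Z := by
  unfold cbRank
  congr 1
  ext α
  rw [mem_ofPred_eq, mem_ofPred_eq, ← preimage_cbDerivative e.isOpenEmbedding,
    Set.preimage_eq_empty_iff]
  simp

theorem IsEndPoint.map {x : X} (hx : IsEndPoint x) (e : X ≃ₜ Z) : IsEndPoint (e x) := by
  unfold IsEndPoint at *
  rw [← cbRank_congr e, ← preimage_cbDerivative e.symm.isOpenEmbedding, hx]
  ext z
  simp [Homeomorph.symm_apply_eq]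

theorem almostHomeomorphic_of_homeomorph {x : X} (hx : IsEndPoint x) (e : X ≃ₜ Z) :
    AlmostHomeomorphic X Z :=
  ⟨x, e x, hx, hx.map e, Set.univ, Set.univ, isClopen_univ, isClopen_univ, trivial, trivial,
    ⟨(Homeomorph.Set.univ X).trans (e.trans (Homeomorph.Set.univ Z).symm)⟩⟩

/-- `R x β` is to be read as "`β` bounds the rank of `x`". If the bounds near `x` are below `β`,
then by induction no other nearby point survives to stage `β`. A relation is used, not a function,
so that points with several descriptions need no canonical one. -/
theorem notMem_cbDerivative_add_one {R : X → Ordinal.{u} → Prop}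
    (hR : ∀ x β, R x β → ∃ U ∈ 𝓝 x, ∀ y ∈ U, y ≠ x → ∃ γ < β, R y γ)
    (β : Ordinal.{u}) : ∀ x, R x β → x ∉ cbDerivative X (β + 1) := by
  induction β using WellFoundedLT.induction with
  | ind β ih =>
    intro x hx hmem
    obtain ⟨U, hU, h⟩ := hR x β hx
    obtain ⟨y, ⟨hyU, hy⟩, hne⟩ :=
      mem_derivedSet_iff.1 (mem_cbDerivative_add_one.1 hmem).1 U hU
    obtain ⟨γ, hγ, hyγ⟩ := h y hyU hne
    exact ih γ hγ y hyγ (cbDerivative_antitone (Order.add_one_le_of_lt hγ) hy)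

theorem isScattered_of_rank {R : X → Ordinal.{u} → Prop}
    (hR : ∀ x β, R x β → ∃ U ∈ 𝓝 x, ∀ y ∈ U, y ≠ x → ∃ γ < β, R y γ)
    (htot : ∀ x, ∃ β, R x β) : IsScattered X := by
  rintro S ⟨x₀, hx₀⟩
  obtain ⟨β₀, h₀⟩ := htot x₀
  have hne : {β | ∃ x ∈ S, R x β}.Nonempty := ⟨β₀, x₀, hx₀, h₀⟩
  obtain ⟨x, hx, hxR⟩ := csInf_mem hne
  refine ⟨x, hx, fun hd => ?_⟩
  obtain ⟨U, hU, h⟩ := hR x _ hxR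
  obtain ⟨y, ⟨hyU, hyS⟩, hyx⟩ := mem_derivedSet_iff.1 hd U hU
  obtain ⟨γ, hγ, hyγ⟩ := h y hyU hyx
  exact notMem_of_lt_csInf' hγ ⟨y, hyS, hyγ⟩

end CantorBendixson

/-! ### The Tikhonov plank -/

namespace TikhonovPlank

/-- The point `(min a ω₁, min b ω)` of the Tikhonov plank. -/
noncomputable def mk (a b : Ordinal.{0}) : TikhonovPlank :=
  (⟨min a ω₁, mem_Iic.2 (min_le_right _ _)⟩, ⟨min b ω, mem_Iic.2 (min_le_right _ _)⟩)

theorem continuous_mk : Continuous fun p : Ordinal.{0} × Ordinal.{0} => mk p.1 p.2 := by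
  have h1 : Continuous fun p : Ordinal.{0} × Ordinal.{0} => min p.1 ω₁ :=
    continuous_fst.min continuous_const
  have h2 : Continuous fun p : Ordinal.{0} × Ordinal.{0} => min p.2 ω :=
    continuous_snd.min continuous_const
  exact (h1.subtype_mk _).prodMk (h2.subtype_mk _)

theorem mk_fst_snd (t : TikhonovPlank) : mk t.1 t.2 = t := by
  refine Prod.ext (Subtype.ext ?_) (Subtype.ext ?_)
  · exact min_eq_left (mem_Iic.1 t.1.2)
  · exact min_eq_left (mem_Iic.1 t.2.2)

theorem coe_fst_mk {a b : Ordinal.{0}} (h : a ≤ ω₁) : ((mk a b).1 : Ordinal) = a :=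
  (min_eq_left h : min a ω₁ = a)

theorem coe_snd_mk {a b : Ordinal.{0}} (h : b ≤ ω) : ((mk a b).2 : Ordinal) = b :=
  (min_eq_left h : min b ω = b)

instance : CompactSpace TikhonovPlank := by
  have h : ∀ o : Ordinal.{0}, CompactSpace (Iic o) := fun o => by
    rw [← isCompact_iff_compactSpace, ← Icc_bot]
    exact isCompact_Icc
  have := h ω₁
  have := h ω
  infer_instance

theorem exists_nat_mem_of_mem_nhds {s : Set Ordinal.{0}} (hs : s ∈ 𝓝 ω) :
    ∃ n : ℕ, (n : Ordinal) ∈ s := by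
  obtain ⟨a, ha, h⟩ := exists_Ioc_subset_of_mem_nhds hs ⟨0, omega0_pos⟩
  obtain ⟨n, rfl⟩ := lt_omega0.1 ha
  exact ⟨n + 1, h ⟨by exact_mod_cast Nat.lt_succ_self n, (natCast_lt_omega0 _).le⟩⟩

/-- Countably many ordinals below `ω₁` have their supremum below `ω₁`, so one column serves all
rows. -/
theorem exists_forall_mem_of_isOpen {V : ℕ → Set TikhonovPlank} (hV : ∀ n, IsOpen (V n))
    (hmem : ∀ n : ℕ, mk ω₁ n ∈ V n) : ∃ β < ω₁, ∀ n : ℕ, mk β n ∈ V n := by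
  have h : ∀ n : ℕ, ∃ a < ω₁, Ioc a ω₁ ⊆ {a | mk a n ∈ V n} := fun n => by
    refine exists_Ioc_subset_of_mem_nhds (IsOpen.mem_nhds ?_ (hmem n)) ⟨0, omega_pos 1⟩
    exact (hV n).preimage (continuous_mk.comp (continuous_id.prodMk continuous_const))
  choose a ha hsub using h
  have hsup : (⨆ n, a n) < ω₁ := Ordinal.iSup_lt_omega_one ha
  have hsup' : (⨆ n, a n) + 1 < ω₁ := (isSuccLimit_omega 1).add_one_lt hsup
  refine ⟨(⨆ n, a n) + 1, hsup', fun n => hsub n ⟨?_, hsup'.le⟩⟩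
  exact (Ordinal.le_iSup a n).trans_lt (lt_add_one _)

/-- The top and the right edge without the corner are separated sets. Every neighbourhood of the
right one contains all `(β, n)` for some `β < ω₁`, and these accumulate at `(β, ω)` on the top edge.
-/
theorem not_completelyNormalSpace : ¬ CompletelyNormalSpace TikhonovPlank := by
  intro _
  let A : Set TikhonovPlank := {t | (t.1 : Ordinal) < ω₁ ∧ (t.2 : Ordinal) = ω}
  let B : Set TikhonovPlank := {t | (t.1 : Ordinal) = ω₁ ∧ (t.2 : Ordinal) < ω}
  have c1 : Continuous fun t : TikhonovPlank => (t.1 : Ordinal) :=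
    continuous_subtype_val.comp continuous_fst
  have c2 : Continuous fun t : TikhonovPlank => (t.2 : Ordinal) :=
    continuous_subtype_val.comp continuous_snd
  have hA : closure A ⊆ {t | (t.2 : Ordinal) = ω} :=
    closure_minimal (fun t ht => ht.2) (isClosed_eq c2 continuous_const)
  have hB : closure B ⊆ {t | (t.1 : Ordinal) = ω₁} :=
    closure_minimal (fun t ht => ht.1) (isClosed_eq c1 continuous_const)
  have hd := completely_normal (s := A) (t := B)
    (Set.disjoint_left.2 fun t h h' => h'.2.ne (hA h))
    (Set.disjoint_left.2 fun t h h' => h.1.ne (hB h'))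
  obtain ⟨U, V, hU, hV, hAU, hBV, hUV⟩ := separatedNhds_iff_disjoint.2 hd
  obtain ⟨β, hβ, h⟩ := exists_forall_mem_of_isOpen (V := fun _ => V) (fun _ => hV)
    fun n => hBV ⟨coe_fst_mk le_rfl, by
      rw [coe_snd_mk (natCast_lt_omega0 n).le]; exact natCast_lt_omega0 n⟩
  have hβU : mk β ω ∈ U := hAU ⟨by rwa [coe_fst_mk hβ.le], coe_snd_mk le_rfl⟩
  have hnb : {b | mk β b ∈ U} ∈ 𝓝 ω := IsOpen.mem_nhds
    (hU.preimage (continuous_mk.comp (continuous_const.prodMk continuous_id))) hβU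
  obtain ⟨n, hn⟩ := exists_nat_mem_of_mem_nhds hnb
  exact Set.disjoint_left.1 hUV hn (h n)

theorem uncountable : Uncountable TikhonovPlank := by
  have : Uncountable (Iic (ω₁ : Ordinal.{0})) := by
    rw [← not_countable_iff, ← mk_le_aleph0_iff, not_le]
    refine lt_of_lt_of_le ?_ (mk_le_mk_of_subset (Iio_subset_Iic_self))
    rw [Cardinal.mk_Iio_ordinal, card_omega, aleph0_lt_lift]
    exact aleph0_lt_aleph_one
  exact Function.Surjective.uncountable (f := Prod.fst)
    fun a => ⟨(a, ⟨0, omega0_pos.le⟩), rfl⟩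

/-- As `ω₁` and `ω` absorb smaller ordinals added on the left, left translation in each coordinate
maps the plank into any neighbourhood of its corner. -/
theorem containsTikhonovPlank_of_mem_nhds {U : Set TikhonovPlank} (hU : U ∈ 𝓝 (mk ω₁ ω)) :
    ContainsTikhonovPlank U := by
  have h := continuous_mk.continuousAt (x := (ω₁, ω)) hU
  rw [Filter.mem_map, mem_nhds_prod_iff] at h
  obtain ⟨u, hu, v, hv, huv⟩ := h
  obtain ⟨a, ha, hau⟩ := exists_Ioc_subset_of_mem_nhds hu ⟨0, omega_pos 1⟩
  obtain ⟨b, hb, hbv⟩ := exists_Ioc_subset_of_mem_nhds hv ⟨0, omega0_pos⟩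
  have ha' := (isSuccLimit_omega 1).add_one_lt ha
  have hb' := isSuccLimit_omega0.add_one_lt hb
  have ea : a + 1 + ω₁ = ω₁ := (isPrincipal_add_omega 1).add_eq_right ha'
  have eb : b + 1 + ω = ω := isPrincipal_add_omega0.add_eq_right hb'
  have la : ∀ t : TikhonovPlank, a + 1 + t.1 ≤ ω₁ := fun t =>
    (add_le_add_right t.1.2 _).trans ea.le
  have lb : ∀ t : TikhonovPlank, b + 1 + t.2 ≤ ω := fun t =>
    (add_le_add_right t.2.2 _).trans eb.le
  refine ⟨fun t => mk (a + 1 + t.1) (b + 1 + t.2), ?_, ?_⟩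
  · refine (Continuous.isClosedEmbedding ?_ ?_).isEmbedding
    · refine continuous_mk.comp (Continuous.prodMk ?_ ?_)
      · exact (isNormal_add_right (a + 1)).continuous.comp
          (continuous_subtype_val.comp continuous_fst)
      · exact (isNormal_add_right (b + 1)).continuous.comp
          (continuous_subtype_val.comp continuous_snd)
    · intro s t hst
      have h1 := congrArg (fun p : TikhonovPlank => (p.1 : Ordinal)) hst
      have h2 := congrArg (fun p : TikhonovPlank => (p.2 : Ordinal)) hst
      simp only [coe_fst_mk (la _), coe_snd_mk (lb _)] at h1 h2
      exact Prod.ext (Subtype.ext (add_left_cancel h1)) (Subtype.ext (add_left_cancel h2))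
  · rintro _ ⟨t, rfl⟩
    refine huv (mk_mem_prod (hau ⟨?_, la t⟩) (hbv ⟨?_, lb t⟩))
    · exact (lt_add_one a).trans_le le_self_add
    · exact (lt_add_one b).trans_le le_self_add

/-- There is no retraction onto the union `K` of the top and right edges. Since `(ω₁, n)` is the
only point of `K` in row `n`, it is isolated in `K`; so for some `β < ω₁` a retraction would send
`(β, n)` to `(ω₁, n)` for all `n`, and by continuity `(β, ω)` to the corner, though it must fix `(β,
ω)`. -/
theorem not_isRetractive {X : Type u} [TopologicalSpace X] [T2Space X] {f : TikhonovPlank → X}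
    (hf : IsEmbedding f) : ¬ IsRetractive X := by
  intro hX
  have c1 : Continuous fun t : TikhonovPlank => (t.1 : Ordinal) :=
    continuous_subtype_val.comp continuous_fst
  have c2 : Continuous fun t : TikhonovPlank => (t.2 : Ordinal) :=
    continuous_subtype_val.comp continuous_snd
  let K : Set TikhonovPlank := {t | (t.1 : Ordinal) = ω₁ ∨ (t.2 : Ordinal) = ω}
  have hK : IsClosed K :=
    (isClosed_eq c1 continuous_const).union (isClosed_eq c2 continuous_const)
  obtain ⟨r, hr⟩ := hX (f '' K) (hK.isCompact.image hf.continuous).isClosed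
    ⟨_, mk ω₁ ω, Or.inr (coe_snd_mk le_rfl), rfl⟩
  -- This is `K` without the single point `(ω₁, n)`.
  let K' : ℕ → Set TikhonovPlank := fun n => K ∩ {t | (t.2 : Ordinal) ≠ n}
  have hK' : ∀ n, IsClosed (f '' K' n) := fun n => by
    refine (IsClosed.isCompact ?_).image hf.continuous |>.isClosed
    refine hK.inter (IsOpen.isClosed_compl (s := {t : TikhonovPlank | (t.2 : Ordinal) = n}) ?_)
    refine IsOpen.preimage (t := {(n : Ordinal)}) c2 (SuccOrder.isOpen_singleton_iff.2 ?_)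
    exact fun h => (natCast_lt_of_isSuccLimit h n).ne rfl
  have hc : Continuous fun t => (r (f t) : X) :=
    continuous_subtype_val.comp (r.continuous.comp hf.continuous)
  have hrK : ∀ t ∈ K, (r (f t) : X) = f t := fun t ht =>
    congrArg Subtype.val (hr ⟨f t, t, ht, rfl⟩)
  obtain ⟨β, hβ, h⟩ := exists_forall_mem_of_isOpen
    (V := fun n => (fun t => (r (f t) : X)) ⁻¹' (f '' K' n)ᶜ)
    (fun n => (hK' n).isOpen_compl.preimage hc) (by
      rintro n ⟨t, ⟨-, ht⟩, hft⟩
      have hm : mk ω₁ n ∈ K := Or.inl (coe_fst_mk le_rfl)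
      replace hft : f t = r (f (mk ω₁ n)) := hft
      rw [hrK _ hm] at hft
      have := hf.injective hft
      subst this
      exact ht (coe_snd_mk (natCast_lt_omega0 n).le))
  have hval : ∀ n : ℕ, (r (f (mk β n)) : X) = f (mk ω₁ n) := by
    intro n
    obtain ⟨t, htK, ht⟩ := (r (f (mk β n))).2
    have hn : (t.2 : Ordinal) = n := by
      by_contra hne
      exact h n ⟨t, ⟨htK, hne⟩, ht⟩
    rw [← ht]
    congr 1
    rcases htK with h1 | h1
    · rw [← mk_fst_snd t, h1, hn]
    · exact absurd (h1.symm.trans hn) (natCast_lt_omega0 n).ne'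
  have hcl : IsClosed {b | (r (f (mk β b)) : X) = f (mk ω₁ b)} :=
    isClosed_eq (hc.comp (continuous_mk.comp (continuous_const.prodMk continuous_id)))
      (hf.continuous.comp (continuous_mk.comp (continuous_const.prodMk continuous_id)))
  have hω : (r (f (mk β ω)) : X) = f (mk ω₁ ω) := by
    by_contra hne
    obtain ⟨n, hn⟩ := exists_nat_mem_of_mem_nhds (hcl.isOpen_compl.mem_nhds hne)
    exact hn (hval n)
  rw [hrK _ (Or.inr (coe_snd_mk le_rfl))] at hω
  have := congrArg (fun p : TikhonovPlank => (p.1 : Ordinal)) (hf.injective hω)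
  simp only [coe_fst_mk hβ.le, coe_fst_mk le_rfl] at this
  exact hβ.ne this

end TikhonovPlank

/-! ### Points all of whose neighbourhoods contain a plank -/

theorem ContainsTikhonovPlank.mono {X : Type u} [TopologicalSpace X] {U V : Set X}
    (h : ContainsTikhonovPlank U) (hUV : U ⊆ V) : ContainsTikhonovPlank V := by
  obtain ⟨f, hf, hr⟩ := h
  exact ⟨f, hf, hr.trans hUV⟩

theorem ContainsTikhonovPlank.image {X : Type u} {Z : Type*} [TopologicalSpace X]
    [TopologicalSpace Z]
    {U : Set Z} (h : ContainsTikhonovPlank U) {j : Z → X} (hj : IsEmbedding j) :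
    ContainsTikhonovPlank (j '' U) := by
  obtain ⟨f, hf, hr⟩ := h
  exact ⟨j ∘ f, hj.comp hf, by rw [range_comp]; exact image_mono hr⟩

theorem not_containsTikhonovPlank_of_countable {X : Type u} [TopologicalSpace X] {U : Set X}
    (hU : U.Countable) : ¬ ContainsTikhonovPlank U := by
  rintro ⟨f, hf, hr⟩
  have := TikhonovPlank.uncountable
  have hc : (range f).Countable := hU.mono hr
  have := hc.to_subtype
  exact not_countable (α := TikhonovPlank)
    ((rangeFactorization_injective.2 hf.injective).countable)

theorem not_containsTikhonovPlank_of_completelyNormalSpace {X : Type u} [TopologicalSpace X]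
    {U : Set X} [CompletelyNormalSpace U] : ¬ ContainsTikhonovPlank U := by
  rintro ⟨f, hf, hr⟩
  have : IsEmbedding (codRestrict f U fun t => hr (mem_range_self t)) := hf.codRestrict _ _
  exact TikhonovPlank.not_completelyNormalSpace this.isInducing.completelyNormalSpace

/-- A continuous bijection from a compact space onto a Hausdorff order topology is a homeomorphism,
and order topologies are completely normal. -/
theorem completelyNormalSpace_of_bijective_linearOrder {U : Type*} {L : Type*}
    [TopologicalSpace U] [CompactSpace U] [LinearOrder L] {f : U → L}
    (hf : Function.Bijective f) (hgt : ∀ x, IsOpen {y | f x < f y})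
    (hlt : ∀ x, IsOpen {y | f y < f x}) : CompletelyNormalSpace U := by
  let _ : TopologicalSpace L := Preorder.topology L
  have : OrderTopology L := ⟨rfl⟩
  have hc : Continuous f := by
    refine continuous_generateFrom_iff.2 ?_
    rintro _ ⟨a, rfl | rfl⟩
    · obtain ⟨x, rfl⟩ := hf.2 a
      exact hgt x
    · obtain ⟨x, rfl⟩ := hf.2 a
      exact hlt x
  exact (hc.isClosedEmbedding hf.1).isInducing.completelyNormalSpace

/-- Inclusion orders `U` linearly. A strict inclusion is witnessed by a single element of `P`, so
the rays are open, and complete normality, being hereditary, excludes a plank. -/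
theorem FinalSegments.not_containsTikhonovPlank_of_isChain {P : Type u} [PartialOrder P]
    {U : Set (FinalSegments P)} (hU : IsClosed U)
    (hc : ∀ F ∈ U, ∀ G ∈ U, F.1 ⊆ G.1 ∨ G.1 ⊆ F.1) : ¬ ContainsTikhonovPlank U := by
  classical
  have : CompactSpace U := isCompact_iff_compactSpace.1 hU.isCompact
  let L : Set (Set P) := Subtype.val '' U
  let _ : LinearOrder L :=
    { (inferInstance : PartialOrder L) with
      le_total := by
        rintro ⟨_, F, hF, rfl⟩ ⟨_, G, hG, rfl⟩
        exact hc F hF G hG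
      toDecidableLE := Classical.decRel _ }
  let f : U → L := fun F => ⟨F.1.1, F.1, F.2, rfl⟩
  have hlt : ∀ F G : U, f F < f G ↔ ∃ p, p ∈ G.1.1 ∧ p ∉ F.1.1 := by
    intro F G
    rw [← not_le, ← Set.not_subset]
    exact Iff.rfl
  have : CompletelyNormalSpace U := by
    refine completelyNormalSpace_of_bijective_linearOrder (f := f) ⟨?_, ?_⟩ ?_ ?_
    · intro F G h
      have h' : F.1.1 = G.1.1 := congrArg (Subtype.val : L → Set P) h
      exact Subtype.ext (Subtype.ext h')
    · rintro ⟨_, F, hF, rfl⟩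
      exact ⟨⟨F, hF⟩, rfl⟩
    · intro F
      simp only [hlt, ofPred_exists]
      refine isOpen_iUnion fun p => ?_
      by_cases hp : p ∈ F.1.1
      · simp [hp]
      · simp only [hp, not_false_eq_true, and_true]
        exact (isClopen_mem p).isOpen.preimage continuous_subtype_val
    · intro F
      simp only [hlt, ofPred_exists]
      refine isOpen_iUnion fun p => ?_
      by_cases hp : p ∈ F.1.1
      · simp only [hp, true_and]
        exact (isClopen_mem p).compl.isOpen.preimage continuous_subtype_val
      · simp [hp]
  exact not_containsTikhonovPlank_of_completelyNormalSpace

/-- The points all of whose neighbourhoods contain a Tikhonov plank. -/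
def plankPoints (X : Type u) [TopologicalSpace X] : Set X :=
  {x | ∀ U ∈ 𝓝 x, ContainsTikhonovPlank U}

theorem preimage_plankPoints {X Z : Type u} [TopologicalSpace X] [TopologicalSpace Z] {j : Z → X}
    (hj : IsOpenEmbedding j) : j ⁻¹' plankPoints X = plankPoints Z := by
  ext z
  constructor
  · intro h U hU
    obtain ⟨f, hf, hr⟩ := h (j '' U) (hj.isOpenMap.image_mem_nhds hU)
    choose g hg hg' using fun t => hr (mem_range_self t)
    refine ⟨g, ?_, by rintro _ ⟨t, rfl⟩; exact hg t⟩
    rw [← hj.isEmbedding.of_comp_iff]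
    convert hf
    exact funext hg'
  · intro h U hU
    exact ((h (j ⁻¹' U) (hj.continuous.continuousAt hU)).image hj.isEmbedding).mono
      (image_preimage_subset _ _)

theorem isClosed_plankPoints (X : Type u) [TopologicalSpace X] : IsClosed (plankPoints X) := by
  rw [← isOpen_compl_iff, isOpen_iff_mem_nhds]
  intro x hx
  have : ∃ U ∈ 𝓝 x, ¬ ContainsTikhonovPlank U := by
    by_contra! h
    exact hx h
  obtain ⟨U, hU, hn⟩ := this
  obtain ⟨V, hVU, hV, hxV⟩ := mem_nhds_iff.1 hU
  exact Filter.mem_of_superset (hV.mem_nhds hxV) fun y hy h =>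
    hn ((h V (hV.mem_nhds hy)).mono hVU)

/-- The set of Cantor–Bendixson ranks of the points of `U` which are limits, but not limits of
limits, of `plankPoints`. -/
def plankLimitRanks {X : Type u} [TopologicalSpace X] (U : Set X) : Set Ordinal.{u} :=
  {α | ∃ x ∈ U, x ∈ derivedSet (plankPoints X) ∧ x ∉ derivedSet (derivedSet (plankPoints X)) ∧
    x ∈ cbDerivative X α ∧ x ∉ cbDerivative X (α + 1)}

theorem plankLimitRanks_range {X Z : Type u} [TopologicalSpace X] [TopologicalSpace Z] {j : Z → X}
    (hj : IsOpenEmbedding j) :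
    plankLimitRanks (range j) = plankLimitRanks (Set.univ : Set Z) := by
  have h1 : j ⁻¹' derivedSet (plankPoints X) = derivedSet (plankPoints Z) := by
    rw [preimage_derivedSet hj, preimage_plankPoints hj]
  have h2 : j ⁻¹' derivedSet (derivedSet (plankPoints X)) =
      derivedSet (derivedSet (plankPoints Z)) := by
    rw [preimage_derivedSet hj, h1]
  ext α
  simp only [plankLimitRanks, mem_ofPred_eq, exists_range_iff, mem_univ, true_and, ← h2]
  simp only [← h1, ← preimage_cbDerivative hj, mem_preimage]

theorem plankLimitRanks_congr {X Z : Type u} [TopologicalSpace X] [TopologicalSpace Z]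
    {U : Set X} {V : Set Z} (hU : IsOpen U) (hV : IsOpen V) (e : U ≃ₜ V) :
    plankLimitRanks U = plankLimitRanks V := by
  have h1 := plankLimitRanks_range hU.isOpenEmbedding_subtypeVal
  have h2 := plankLimitRanks_range (hV.isOpenEmbedding_subtypeVal.comp e.isOpenEmbedding)
  rw [range_comp, e.surjective.range_eq, image_univ, Subtype.range_coe] at h2
  rw [Subtype.range_coe] at h1
  rw [h1, h2]

/-! ### The exponent of the last term of the Cantor normal form -/

theorem one_le_sub_of_lt {a b : Ordinal.{u}} (h : a < b) : 1 ≤ b - a :=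
  Order.one_le_iff_pos.2 (pos_iff_ne_zero.2 fun h' => h.not_ge (Ordinal.sub_eq_zero_iff_le.1 h'))

/-- Induction along the Cantor normal form: the remainder modulo the leading power is smaller than
`e`, and if it vanishes then `e` is a finite multiple of that power. -/
theorem exists_eq_omega0_opow_mul {e : Ordinal.{u}} (he : e ≠ 0) :
    ∃ a m : Ordinal.{u}, e = ω ^ a * (m + 1) := by
  induction e using WellFoundedLT.induction with
  | ind e ih =>
    set b := log ω e
    have hdm := div_add_mod e (ω ^ b)
    by_cases hs : e % ω ^ b = 0
    · have hlt : e / ω ^ b < ω := div_opow_log_lt e one_lt_omega0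
      obtain ⟨n, hn⟩ := lt_omega0.1 hlt
      rw [hs, add_zero, hn] at hdm
      cases n with
      | zero => exact absurd (by simpa using hdm.symm) he
      | succ n => exact ⟨b, n, by rw [← hdm]; push_cast; rfl⟩
    · have hlt : e % ω ^ b < ω ^ b := mod_lt _ (opow_ne_zero _ omega0_ne_zero)
      obtain ⟨a, m, hm⟩ := ih _ (mod_opow_log_lt_self ω he) hs
      have hab : a ≤ b := by
        rw [← opow_le_opow_iff_right one_lt_omega0]
        refine le_trans ?_ hlt.le
        rw [hm]
        exact le_mul_left _ (by simp)
      refine ⟨a, ω ^ (b - a) * (e / ω ^ b) + m, ?_⟩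
      rw [add_assoc, mul_add, ← hm, ← mul_assoc, ← opow_add, Ordinal.add_sub_cancel_of_le hab, hdm]

open Classical in
/-- The exponent of the last term of the Cantor normal form of a nonzero ordinal. -/
noncomputable def lastExp (e : Ordinal.{u}) : Ordinal.{u} :=
  if h : e ≠ 0 then (exists_eq_omega0_opow_mul h).choose else 0

theorem exists_eq_opow_lastExp_mul {e : Ordinal.{u}} (he : e ≠ 0) :
    ∃ m : Ordinal.{u}, e = ω ^ lastExp e * (m + 1) := by
  rw [lastExp, dif_pos he]
  exact (exists_eq_omega0_opow_mul he).choose_spec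

/-- A larger power of `ω` dividing `e` would force `ω` to divide the successor `m + 1`. -/
theorem opow_dvd_iff_le_lastExp {e : Ordinal.{u}} (he : e ≠ 0) {a : Ordinal.{u}} :
    ω ^ a ∣ e ↔ a ≤ lastExp e := by
  obtain ⟨m, hm⟩ := exists_eq_opow_lastExp_mul he
  constructor
  · rintro ⟨k, hk⟩
    by_contra! hlt
    have h1 : ω ^ lastExp e * (m + 1) = ω ^ lastExp e * (ω ^ (a - lastExp e) * k) := by
      rw [← mul_assoc, ← opow_add, Ordinal.add_sub_cancel_of_le hlt.le, ← hk, ← hm]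
    have h2 : m + 1 = ω ^ (a - lastExp e) * k :=
      mul_left_cancel₀ (opow_ne_zero _ omega0_ne_zero) h1
    have h3 : ω ∣ m + 1 := by
      rw [h2]
      refine Dvd.dvd.mul_right ?_ _
      simpa using opow_dvd_opow ω (b := 1) (c := a - lastExp e)
        (one_le_sub_of_lt hlt)
    have h4 := isSuccPrelimit_iff_omega0_dvd.2 h3
    exact Order.not_isSuccPrelimit_succ m (by rwa [Order.succ_eq_add_one])
  · intro h
    refine (opow_dvd_opow ω h).trans ?_
    exact ⟨m + 1, hm⟩

theorem lastExp_opow_mul (a m : Ordinal.{u}) : lastExp (ω ^ a * (m + 1)) = a := by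
  have he : ω ^ a * (m + 1) ≠ 0 := mul_ne_zero (opow_ne_zero _ omega0_ne_zero) (by simp)
  obtain ⟨k, hk⟩ := exists_eq_opow_lastExp_mul he
  refine le_antisymm ?_ ((opow_dvd_iff_le_lastExp he).1 ⟨_, rfl⟩)
  by_contra! hlt
  rw [← Ordinal.add_sub_cancel_of_le hlt.le, opow_add, mul_assoc] at hk
  have h2 := mul_left_cancel₀ (opow_ne_zero _ omega0_ne_zero) hk
  have h3 : ω ∣ m + 1 := by
    rw [h2]
    refine Dvd.dvd.mul_right ?_ _
    simpa using opow_dvd_opow ω (b := 1) (c := lastExp (ω ^ a * (m + 1)) - a)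
      (one_le_sub_of_lt hlt)
  exact Order.not_isSuccPrelimit_succ m
    (by rw [Order.succ_eq_add_one]; exact isSuccPrelimit_iff_omega0_dvd.2 h3)

theorem lastExp_opow (a : Ordinal.{u}) : lastExp (ω ^ a) = a := by
  simpa using lastExp_opow_mul a 0

theorem lastExp_opow_add_opow {a b : Ordinal.{u}} (h : b ≤ a) : lastExp (ω ^ a + ω ^ b) = b := by
  have := lastExp_opow_mul b (ω ^ (a - b))
  rwa [mul_add, mul_one, ← opow_add, Ordinal.add_sub_cancel_of_le h] at this

theorem lastExp_lt {e r : Ordinal.{u}} (he : e ≠ 0) (h : e < ω ^ r) : lastExp e < r := by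
  rw [← opow_lt_opow_iff_right one_lt_omega0]
  exact (le_of_dvd he ((opow_dvd_iff_le_lastExp he).2 le_rfl)).trans_lt h

/-- No ordinal strictly between two consecutive multiples of `ω ^ lastExp e` is divisible by that
power. Together with `exists_between_le_lastExp` this makes `lastExp e` the Cantor–Bendixson rank of
`e ≠ 0` among the ordinals. -/
theorem exists_forall_lastExp_lt {e : Ordinal.{u}} (he : e ≠ 0) :
    ∃ b < e, ∀ x, b < x → x < e → lastExp x < lastExp e := by
  obtain ⟨m, hm⟩ := exists_eq_opow_lastExp_mul he
  have hp : (0 : Ordinal) < ω ^ lastExp e := opow_pos _ omega0_pos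
  refine ⟨ω ^ lastExp e * m, ?_, fun x hx hxe => ?_⟩
  · conv_rhs => rw [hm]
    exact (mul_lt_mul_iff_right₀ hp).2 (lt_add_one m)
  · by_contra! hle
    have hx0 : x ≠ 0 := (bot_le.trans_lt hx).ne'
    obtain ⟨k, hk⟩ := (opow_dvd_iff_le_lastExp hx0).2 hle
    rw [hk] at hx
    rw [hk] at hxe
    conv_rhs at hxe => rw [hm]
    have h1 := (mul_lt_mul_iff_right₀ hp).1 hx
    have h2 := (mul_lt_mul_iff_right₀ hp).1 hxe
    exact h1.not_ge (Order.lt_add_one_iff.1 h2)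

/-- Here `e` is `ω ^ β` times a limit ordinal, so the multiples of `ω ^ β` are cofinal below it. -/
theorem exists_between_le_lastExp {e b β : Ordinal.{u}} (hβ : β < lastExp e) (hb : b < e) :
    ∃ x, b < x ∧ x < e ∧ β ≤ lastExp x := by
  have he : e ≠ 0 := (bot_le.trans_lt hb).ne'
  obtain ⟨k, hk⟩ := (opow_dvd_iff_le_lastExp he).2 (Order.add_one_le_of_lt hβ)
  rw [opow_add, opow_one, mul_assoc] at hk
  have hk0 : ω * k ≠ 0 := by
    intro h
    rw [h, mul_zero] at hk
    exact he hk
  have hlim : Order.IsSuccLimit (ω * k) := Ordinal.isSuccLimit_iff.2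
      ⟨hk0, isSuccPrelimit_iff_omega0_dvd.2 ⟨k, rfl⟩⟩
  have hp : (0 : Ordinal) < ω ^ β := opow_pos _ omega0_pos
  rw [hk, lt_mul_iff_of_isSuccLimit hlim] at hb
  obtain ⟨y, hy, hby⟩ := hb
  refine ⟨ω ^ β * y, hby, ?_, ?_⟩
  · rw [hk]
    exact (mul_lt_mul_iff_right₀ hp).2 hy
  · exact (opow_dvd_iff_le_lastExp (bot_le.trans_lt hby).ne').1 ⟨y, rfl⟩

/-! ### A sparse set of ordinals -/

theorem mem_derivedSet_ordinal {S : Set Ordinal.{u}} {e : Ordinal.{u}} :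
    e ∈ derivedSet S ↔ e ≠ 0 ∧ ∀ b < e, ∃ x ∈ S, b < x ∧ x < e := by
  rw [mem_derivedSet, accPt_iff_nhds]
  constructor
  · intro h
    constructor
    · rintro rfl
      obtain ⟨y, ⟨hy, -⟩, hne⟩ := h (Iio 1) (Iio_mem_nhds zero_lt_one)
      exact hne (by simpa using hy)
    · intro b hb
      obtain ⟨y, ⟨⟨hby, hye⟩, hyS⟩, hne⟩ := h (Ioo b (e + 1)) (Ioo_mem_nhds hb (lt_add_one e))
      exact ⟨y, hyS, hby, lt_of_le_of_ne (Order.lt_add_one_iff.1 hye) hne⟩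
  · rintro ⟨h0, h⟩ U hU
    obtain ⟨b, hb, hsub⟩ := exists_Ioc_subset_of_mem_nhds hU ⟨0, pos_iff_ne_zero.2 h0⟩
    obtain ⟨x, hx, hbx, hxe⟩ := h b hb
    exact ⟨x, ⟨hsub ⟨hbx, hxe.le⟩, hx⟩, hxe.ne⟩

/-- The set of the ordinals `ω ^ a + ω ^ g a * n` with `a ∈ A` and `n` finite. -/
def sparseSet (A : Set Ordinal.{u}) (g : Ordinal.{u} → Ordinal.{u}) : Set Ordinal.{u} :=
  {d | ∃ a ∈ A, ∃ n : ℕ, d = ω ^ a + ω ^ g a * n}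

section SparseSet

variable {A : Set Ordinal.{u}} {g : Ordinal.{u} → Ordinal.{u}}

/-- The cluster of an exponent, its limit included, stays below the next power of `ω`; so distinct
clusters do not interleave. -/
theorem opow_add_opow_lt {a b : Ordinal.{u}} (h : b < a) : ω ^ a + ω ^ (b + 1) < ω ^ (a + 1) := by
  have h1 : ω ^ (b + 1) ≤ ω ^ a := opow_le_opow_right omega0_pos (Order.add_one_le_of_lt h)
  have h2 : ω ^ a < ω ^ (a + 1) := (opow_lt_opow_iff_right one_lt_omega0).2 (lt_add_one a)
  exact isPrincipal_add_omega0_opow _ h2 (h1.trans_lt h2)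

theorem opow_add_opow_mul_lt (a b : Ordinal.{u}) (n : ℕ) :
    ω ^ a + ω ^ b * n + 1 < ω ^ a + ω ^ (b + 1) := by
  have hlim : Order.IsSuccLimit (ω ^ a + ω ^ (b + 1)) :=
    isSuccLimit_add _ (isSuccLimit_opow_left isSuccLimit_omega0 (by simp))
  refine hlim.add_one_lt (add_lt_add_right ?_ _)
  exact opow_mul_lt_opow (natCast_lt_omega0 n) (lt_add_one b)

theorem exists_lt_opow_add_opow_mul {a b x : Ordinal.{u}} (h : x < ω ^ a + ω ^ (b + 1)) :
    ∃ n : ℕ, x < ω ^ a + ω ^ b * n := by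
  rw [lt_add_iff (opow_ne_zero _ omega0_ne_zero)] at h
  obtain ⟨d, hd, hx⟩ := h
  rw [← Order.succ_eq_add_one, lt_omega0_opow_succ] at hd
  obtain ⟨n, hn⟩ := hd
  exact ⟨n, hx.trans_lt (add_lt_add_right hn _)⟩

/-- A limit of `sparseSet A g` strictly between two powers of `ω`. -/
theorem eq_of_mem_derivedSet_sparseSet (hg : ∀ a ∈ A, g a < a) {x a : Ordinal.{u}}
    (hx : x ∈ derivedSet ((· + 1) '' sparseSet A g)) (h1 : ω ^ a < x) (h2 : x < ω ^ (a + 1)) :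
    a ∈ A ∧ x = ω ^ a + ω ^ (g a + 1) := by
  rw [mem_derivedSet_ordinal] at hx
  have key : ∀ y ∈ (· + 1) '' sparseSet A g, ω ^ a < y → y < x →
      a ∈ A ∧ ∃ n : ℕ, y = ω ^ a + ω ^ g a * n + 1 := by
    rintro _ ⟨_, ⟨a', ha', n, rfl⟩, rfl⟩ hy1 hy2
    have h3 : a' < a + 1 := by
      rw [← opow_lt_opow_iff_right one_lt_omega0]
      refine lt_of_le_of_lt ?_ (hy2.trans h2)
      simp only [add_assoc]
      exact le_self_add
    have h4 : a < a' + 1 := by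
      rw [← opow_lt_opow_iff_right one_lt_omega0]
      exact hy1.trans ((opow_add_opow_mul_lt _ _ _).trans (opow_add_opow_lt (hg a' ha')))
    have : a' = a := le_antisymm (Order.lt_add_one_iff.1 h3) (Order.lt_add_one_iff.1 h4)
    subst this
    exact ⟨ha', n, rfl⟩
  obtain ⟨y₀, hy₀, hy₀a, hy₀x⟩ := hx.2 _ h1
  have ha := (key y₀ hy₀ hy₀a hy₀x).1
  refine ⟨ha, ?_⟩
  rcases lt_trichotomy x (ω ^ a + ω ^ (g a + 1)) with hlt | heq | hgt
  · exfalso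
    have hex : ∃ n : ℕ, x ≤ ω ^ a + ω ^ g a * n := by
      obtain ⟨n, hn⟩ := exists_lt_opow_add_opow_mul hlt
      exact ⟨n, hn.le⟩
    classical
    have hN := Nat.find_spec hex
    have hmin : ∀ n : ℕ, n < Nat.find hex → ω ^ a + ω ^ g a * n < x :=
      fun n hn => not_le.1 (Nat.find_min hex hn)
    generalize Nat.find hex = N at hN hmin
    cases N with
    | zero => exact h1.not_ge (by simpa using hN)
    | succ N =>
      have hle : ∀ n : ℕ, ω ^ a + ω ^ g a * n + 1 < x → n ≤ N := by
        intro n hn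
        by_contra! hlt'
        have : ω ^ a + ω ^ g a * (N + 1 : ℕ) ≤ ω ^ a + ω ^ g a * (n : ℕ) :=
          add_le_add_right (mul_le_mul_right (Nat.cast_le.2 hlt') _) _
        exact (((lt_add_one _).trans hn).trans_le (hN.trans this)).false
      -- Two approximants are needed: the first may be the shifted point `ω ^ a + ω ^ g a * N + 1`
      -- itself, but nothing of the cluster lies between that point and `x`.
      obtain ⟨y₁, hy₁, hb₁, hx₁⟩ := hx.2 _ (hmin N N.lt_succ_self)
      have ha₁ : ω ^ a < y₁ := lt_of_le_of_lt le_self_add hb₁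
      obtain ⟨y₂, hy₂, hb₂, hx₂⟩ := hx.2 _ hx₁
      obtain ⟨n, rfl⟩ := (key y₂ hy₂ (ha₁.trans hb₂) hx₂).2
      have : ω ^ a + ω ^ g a * (n : ℕ) ≤ ω ^ a + ω ^ g a * (N : ℕ) :=
        add_le_add_right (mul_le_mul_right (Nat.cast_le.2 (hle n hx₂)) _) _
      have h3 : y₁ ≤ ω ^ a + ω ^ g a * (N : ℕ) := Order.lt_add_one_iff.1
        (hb₂.trans_le (add_le_add_left this 1))
      exact hb₁.not_ge h3
  · exact heq
  · exfalso
    obtain ⟨y, hy, hb, hyx⟩ := hx.2 _ hgt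
    obtain ⟨n, rfl⟩ := (key y hy (lt_of_le_of_lt le_self_add hb) hyx).2
    exact hb.not_gt (opow_add_opow_mul_lt _ _ _)

theorem mem_derivedSet_sparseSet {a : Ordinal.{u}} (ha : a ∈ A) :
    ω ^ a + ω ^ (g a + 1) ∈ derivedSet ((· + 1) '' sparseSet A g) := by
  refine mem_derivedSet_ordinal.2 ⟨?_, fun b hb => ?_⟩
  · exact (lt_of_lt_of_le (opow_pos a omega0_pos) le_self_add).ne'
  · obtain ⟨n, hn⟩ := exists_lt_opow_add_opow_mul hb
    exact ⟨_, ⟨_, ⟨a, ha, n, rfl⟩, rfl⟩, hn.trans (lt_add_one _), opow_add_opow_mul_lt _ _ _⟩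

theorem notMem_derivedSet_derivedSet_sparseSet (hg : ∀ a ∈ A, g a < a) {a : Ordinal.{u}}
    (ha : a ∈ A) : ω ^ a + ω ^ (g a + 1) ∉
      derivedSet (derivedSet ((· + 1) '' sparseSet A g)) := by
  intro h
  obtain ⟨x, hx, h1, h2⟩ := (mem_derivedSet_ordinal.1 h).2 (ω ^ a)
    (lt_add_of_pos_right _ (opow_pos _ omega0_pos))
  exact h2.ne (eq_of_mem_derivedSet_sparseSet hg hx h1 (h2.trans (opow_add_opow_lt (hg a ha)))).2

/-- If `x` lies strictly between two powers of `ω`, it is the limit of a cluster. If `x` is a power,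
every cluster with a member below `x` has its limit below `x` too, so `x` is a limit of limits. -/
theorem exists_eq_of_mem_derivedSet_sparseSet (hg : ∀ a ∈ A, g a < a) {x : Ordinal.{u}}
    (hx : x ∈ derivedSet ((· + 1) '' sparseSet A g))
    (hx' : x ∉ derivedSet (derivedSet ((· + 1) '' sparseSet A g))) :
    ∃ a ∈ A, x = ω ^ a + ω ^ (g a + 1) := by
  have hx0 := (mem_derivedSet_ordinal.1 hx).1
  have h2 : x < ω ^ (log ω x + 1) := lt_opow_succ_log_self one_lt_omega0 x
  rcases (opow_log_le_self ω hx0).lt_or_eq with h1 | h1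
  · obtain ⟨ha, h⟩ := eq_of_mem_derivedSet_sparseSet hg hx h1 h2
    exact ⟨_, ha, h⟩
  · refine absurd (mem_derivedSet_ordinal.2 ⟨hx0, fun b hb => ?_⟩) hx'
    obtain ⟨_, ⟨_, ⟨a, ha, n, rfl⟩, rfl⟩, hby, hyx⟩ := (mem_derivedSet_ordinal.1 hx).2 b hb
    refine ⟨_, mem_derivedSet_sparseSet ha, hby.trans (opow_add_opow_mul_lt _ _ _), ?_⟩
    refine (opow_add_opow_lt (hg a ha)).trans_le ?_
    rw [← h1]
    refine opow_le_opow_right omega0_pos (Order.add_one_le_of_lt ?_)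
    rw [← opow_lt_opow_iff_right one_lt_omega0, h1]
    refine lt_of_le_of_lt ?_ hyx
    simp only [add_assoc]
    exact le_self_add

theorem lt_of_mem_sparseSet (hg : ∀ a ∈ A, g a < a) {r : Ordinal.{u}} (hA : ∀ a ∈ A, a < r)
    {d : Ordinal.{u}} (hd : d ∈ sparseSet A g) : d < ω ^ r := by
  obtain ⟨a, ha, n, rfl⟩ := hd
  refine ((lt_add_one _).trans (opow_add_opow_mul_lt _ _ _)).trans
    ((opow_add_opow_lt (hg a ha)).trans_le ?_)
  exact opow_le_opow_right omega0_pos (Order.add_one_le_of_lt (hA a ha))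

end SparseSet

/-! ### Ordinals with some points blown up to planks -/

/-- The ordinal represented by an element of `o.ToType`. -/
noncomputable def tp {o : Ordinal.{u}} (w : o.ToType) : Ordinal.{u} := (ToType.toOrd w).1

theorem tp_lt {o : Ordinal.{u}} (w : o.ToType) : tp w < o := (ToType.toOrd w).2

theorem tp_le_tp {o : Ordinal.{u}} {v w : o.ToType} : tp v ≤ tp w ↔ v ≤ w :=
  (ToType.mk (o := o)).symm.le_iff_le

theorem tp_lt_tp {o : Ordinal.{u}} {v w : o.ToType} : tp v < tp w ↔ v < w :=
  (ToType.mk (o := o)).symm.lt_iff_lt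

theorem tp_injective {o : Ordinal.{u}} : Function.Injective (tp : o.ToType → Ordinal.{u}) :=
  fun _ _ h => le_antisymm (tp_le_tp.1 h.le) (tp_le_tp.1 h.ge)

theorem exists_tp_eq {o a : Ordinal.{u}} (h : a < o) : ∃ w : o.ToType, tp w = a :=
  ⟨ToType.mk ⟨a, h⟩, by simp [tp]⟩

/-- The lexicographic sum over the ordinal `Λ` of the posets `ω₁ ⊔ ω` at the places `d ∈ D`
and of one-point posets at the other places. -/
def BlowUp (Λ : Ordinal.{u}) (D : Set Ordinal.{u}) : Type u :=
  {x : Λ.ToType ×ₗ ((ω₁ : Ordinal.{0}).ToType ⊕ ℕ) //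
    tp (ofLex x).1 ∈ D ∨ ∃ a, (ofLex x).2 = Sum.inl a ∧ tp a = 0}

namespace BlowUp

variable {Λ : Ordinal.{u}} {D : Set Ordinal.{u}}

noncomputable instance : PartialOrder (BlowUp Λ D) := Subtype.partialOrder _

/-- The place of an element of `BlowUp Λ D`. -/
noncomputable def pos (p : BlowUp Λ D) : Ordinal.{u} := tp (ofLex p.1).1

/-- The position of an element of `BlowUp Λ D` in its summand. -/
def inner (p : BlowUp Λ D) : (ω₁ : Ordinal.{0}).ToType ⊕ ℕ := (ofLex p.1).2

theorem pos_lt (p : BlowUp Λ D) : p.pos < Λ := tp_lt _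

theorem le_iff {p q : BlowUp Λ D} :
    p ≤ q ↔ p.pos < q.pos ∨ p.pos = q.pos ∧ p.inner ≤ q.inner := by
  rw [pos, pos, tp_lt_tp, tp_injective.eq_iff]
  exact Prod.Lex.le_iff

theorem lt_iff {p q : BlowUp Λ D} :
    p < q ↔ p.pos < q.pos ∨ p.pos = q.pos ∧ p.inner < q.inner := by
  rw [pos, pos, tp_lt_tp, tp_injective.eq_iff]
  exact Prod.Lex.lt_iff

theorem mem_or_inner (p : BlowUp Λ D) : p.pos ∈ D ∨ ∃ a, p.inner = Sum.inl a ∧ tp a = 0 := p.2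

theorem exists_base {e : Ordinal.{u}} (he : e < Λ) :
    ∃ p : BlowUp Λ D, p.pos = e ∧ ∃ a, p.inner = Sum.inl a ∧ tp a = 0 := by
  obtain ⟨w, rfl⟩ := exists_tp_eq he
  obtain ⟨a, ha⟩ := exists_tp_eq (omega_pos 1)
  exact ⟨⟨toLex (w, Sum.inl a), Or.inr ⟨a, rfl, ha⟩⟩, rfl, a, rfl, ha⟩

theorem exists_left {d : Ordinal.{u}} (hd : d ∈ D) (hdΛ : d < Λ) {α : Ordinal.{0}} (hα : α < ω₁) :
    ∃ p : BlowUp Λ D, p.pos = d ∧ ∃ a, p.inner = Sum.inl a ∧ tp a = α := by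
  obtain ⟨w, rfl⟩ := exists_tp_eq hdΛ
  obtain ⟨a, ha⟩ := exists_tp_eq hα
  exact ⟨⟨toLex (w, Sum.inl a), Or.inl hd⟩, rfl, a, rfl, ha⟩

theorem exists_right {d : Ordinal.{u}} (hd : d ∈ D) (hdΛ : d < Λ) (m : ℕ) :
    ∃ p : BlowUp Λ D, p.pos = d ∧ p.inner = Sum.inr m := by
  obtain ⟨w, rfl⟩ := exists_tp_eq hdΛ
  exact ⟨⟨toLex (w, Sum.inr m), Or.inl hd⟩, rfl, rfl⟩

instance : WellFoundedLT (BlowUp Λ D) := by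
  let f : BlowUp Λ D → Ordinal.{u} × Ordinal.{0} := fun p =>
    (p.pos, Sum.elim (fun a => tp a) (fun m : ℕ => (m : Ordinal)) p.inner)
  have hwf : WellFounded (Prod.Lex (· < ·) (· < ·) : Ordinal.{u} × Ordinal.{0} → _ → Prop) :=
    WellFounded.prod_lex wellFounded_lt wellFounded_lt
  refine ⟨Subrelation.wf (r := InvImage _ f) ?_ (InvImage.wf f hwf)⟩
  intro p q h
  rcases lt_iff.1 h with h | ⟨h, h'⟩
  · exact Prod.Lex.left _ _ h
  · refine Prod.lex_def.2 (Or.inr ⟨h, ?_⟩)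
    change Sum.elim _ _ p.inner < Sum.elim _ _ q.inner
    revert h'
    rcases p.inner with a | m <;> rcases q.inner with b | n <;> intro h'
    · exact tp_lt_tp.2 (Sum.inl_lt_inl_iff.1 h')
    · exact absurd h' Sum.not_inl_lt_inr
    · exact absurd h' Sum.not_inr_lt_inl
    · exact Nat.cast_lt.2 (Sum.inr_lt_inr_iff.1 h')

/-- The chains are the left and the right elements. A one-point summand carries the left label `0`
and so belongs to the first. -/
theorem isUnionOfTwoWellOrders (Λ : Ordinal.{u}) (D : Set Ordinal.{u}) :
    IsUnionOfTwoWellOrders (BlowUp Λ D) := by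
  have hwf : ∀ s : Set (BlowUp Λ D), s.IsWF := fun s =>
    Set.IsWF.mono (Set.isWF_univ_iff.2 inferInstance) (subset_univ s)
  refine ⟨{p | ∃ a, p.inner = Sum.inl a}, {p | ∃ m, p.inner = Sum.inr m}, ?_,
    ⟨?_, hwf _⟩, ⟨?_, hwf _⟩⟩
  · refine eq_univ_of_forall fun p => ?_
    rcases h : p.inner with a | m
    · exact Or.inl ⟨a, h⟩
    · exact Or.inr ⟨m, h⟩
  · rintro p ⟨a, ha⟩ q ⟨b, hb⟩ -
    simp only [le_iff, ha, hb, Sum.inl_le_inl_iff]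
    rcases lt_trichotomy p.pos q.pos with h | h | h
    · exact Or.inl (Or.inl h)
    · exact (le_total a b).imp (fun h' => Or.inr ⟨h, h'⟩) (fun h' => Or.inr ⟨h.symm, h'⟩)
    · exact Or.inr (Or.inl h)
  · rintro p ⟨a, ha⟩ q ⟨b, hb⟩ -
    simp only [le_iff, ha, hb, Sum.inr_le_inr_iff]
    rcases lt_trichotomy p.pos q.pos with h | h | h
    · exact Or.inl (Or.inl h)
    · exact (le_total a b).imp (fun h' => Or.inr ⟨h, h'⟩) (fun h' => Or.inr ⟨h.symm, h'⟩)
    · exact Or.inr (Or.inl h)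

/-! #### The final segments -/

/-- The final segment of the elements at the places `≥ e`. -/
def cut (e : Ordinal.{u}) : FinalSegments (BlowUp Λ D) :=
  ⟨{p | e ≤ p.pos}, fun x y hx hxy => by
    rcases le_iff.1 hxy with h | ⟨h, -⟩
    · exact (show e ≤ x.pos from hx).trans h.le
    · exact (show e ≤ x.pos from hx).trans h.le⟩

/-- The final segment of `ω₁ ⊔ ω` given by a pair of ordinals. -/
def InnerMem (α n : Ordinal.{0}) : (ω₁ : Ordinal.{0}).ToType ⊕ ℕ → Prop :=
  Sum.elim (fun a => α ≤ tp a) (fun m => n ≤ (m : Ordinal))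

theorem InnerMem.mono {α n : Ordinal.{0}} {x y : (ω₁ : Ordinal.{0}).ToType ⊕ ℕ}
    (h : InnerMem α n x) (hxy : x ≤ y) : InnerMem α n y := by
  rcases x with a | m <;> rcases y with b | k
  · exact le_trans (h : α ≤ tp a) (tp_le_tp.2 (Sum.inl_le_inl_iff.1 hxy))
  · exact absurd hxy Sum.not_inl_le_inr
  · exact absurd hxy Sum.not_inr_le_inl
  · exact le_trans (h : n ≤ m) (Nat.cast_le.2 (Sum.inr_le_inr_iff.1 hxy))

/-- The final segment given by a pair of ordinals at the place `d`. -/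
def pt (d : Ordinal.{u}) (α n : Ordinal.{0}) : FinalSegments (BlowUp Λ D) :=
  ⟨{p | d < p.pos ∨ p.pos = d ∧ InnerMem α n p.inner}, fun x y hx hxy => by
    rcases (hx : d < x.pos ∨ x.pos = d ∧ InnerMem α n x.inner) with h | ⟨h, h'⟩
    · rcases le_iff.1 hxy with h2 | ⟨h2, -⟩
      · exact Or.inl (h.trans h2)
      · exact Or.inl (h.trans_le h2.le)
    · rcases le_iff.1 hxy with h2 | ⟨h2, h3⟩
      · exact Or.inl (h.symm.trans_lt h2)
      · exact Or.inr ⟨h2.symm.trans h, h'.mono h3⟩⟩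

theorem mem_cut {e : Ordinal.{u}} {p : BlowUp Λ D} : p ∈ (cut e : FinalSegments _).1 ↔ e ≤ p.pos :=
  Iff.rfl

theorem mem_pt {d : Ordinal.{u}} {α n : Ordinal.{0}} {p : BlowUp Λ D} :
    p ∈ (pt d α n : FinalSegments _).1 ↔ d < p.pos ∨ p.pos = d ∧ InnerMem α n p.inner :=
  Iff.rfl

theorem cut_subset_cut {e e' : Ordinal.{u}} (he' : e' ≤ Λ) :
    (cut e : FinalSegments (BlowUp Λ D)).1 ⊆ (cut e').1 ↔ e' ≤ e := by
  constructor
  · intro h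
    by_contra! hlt
    obtain ⟨p, hp, -⟩ := exists_base (D := D) (hlt.trans_le he')
    have : e' ≤ p.pos := h (mem_cut.2 hp.ge)
    exact hlt.not_ge (hp ▸ this)
  · exact fun h p hp => h.trans (mem_cut.1 hp)

theorem cut_injOn : InjOn (cut : Ordinal.{u} → FinalSegments (BlowUp Λ D)) (Iic Λ) := by
  intro e he e' he' h
  exact le_antisymm ((cut_subset_cut he).1 (by rw [h])) ((cut_subset_cut he').1 (by rw [h]))

/-- The pairs `(α, n)` that give final segments of `ω₁ ⊔ ω` different from `∅` and from the
whole poset. -/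
structure IsProper (α n : Ordinal.{0}) : Prop where
  left_le : α ≤ ω₁
  right_le : n ≤ ω
  lt_or_lt : α < ω₁ ∨ n < ω
  pos_or_pos : 0 < α ∨ 0 < n

section Subset

variable {d : Ordinal.{u}} {α n : Ordinal.{0}}

theorem le_of_pt_subset (hd : d ∈ D) (hdΛ : d < Λ) {α' n' : Ordinal.{0}} {d' : Ordinal.{u}}
    (h : IsProper α n)
    (hs : (pt d α n : FinalSegments (BlowUp Λ D)).1 ⊆ (pt d' α' n').1) : d' ≤ d := by
  rcases h.lt_or_lt with h | h
  · obtain ⟨p, hp, a, ha, hα⟩ := exists_left hd hdΛ h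
    have := hs (mem_pt.2 (Or.inr ⟨hp, by rw [ha]; exact hα.ge⟩))
    rcases mem_pt.1 this with h1 | h1
    · exact (hp ▸ h1).le
    · exact (hp ▸ h1.1).ge
  · obtain ⟨k, rfl⟩ := lt_omega0.1 h
    obtain ⟨p, hp, hk⟩ := exists_right hd hdΛ k
    have := hs (mem_pt.2 (Or.inr ⟨hp, by rw [hk]; exact le_refl (k : Ordinal)⟩))
    rcases mem_pt.1 this with h1 | h1
    · exact (hp ▸ h1).le
    · exact (hp ▸ h1.1).ge

theorem left_le_of_pt_subset (hd : d ∈ D) (hdΛ : d < Λ) {α' n' : Ordinal.{0}} (hα' : α' ≤ ω₁)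
    (hs : (pt d α n : FinalSegments (BlowUp Λ D)).1 ⊆ (pt d α' n').1) : α' ≤ α := by
  by_contra! hlt
  obtain ⟨p, hp, a, ha, hα⟩ := exists_left hd hdΛ (hlt.trans_le hα')
  have := hs (mem_pt.2 (Or.inr ⟨hp, by rw [ha]; exact hα.ge⟩))
  rcases mem_pt.1 this with h1 | h1
  · exact (hp ▸ h1).false
  · have h2 := h1.2
    rw [ha] at h2
    exact hlt.not_ge (hα ▸ (h2 : α' ≤ tp a))

theorem right_le_of_pt_subset (hd : d ∈ D) (hdΛ : d < Λ) {α' n' : Ordinal.{0}} (hn' : n' ≤ ω)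
    (hs : (pt d α n : FinalSegments (BlowUp Λ D)).1 ⊆ (pt d α' n').1) : n' ≤ n := by
  by_contra! hlt
  obtain ⟨k, rfl⟩ := lt_omega0.1 (hlt.trans_le hn')
  obtain ⟨p, hp, hk⟩ := exists_right hd hdΛ k
  have := hs (mem_pt.2 (Or.inr ⟨hp, by rw [hk]; exact le_refl (k : Ordinal)⟩))
  rcases mem_pt.1 this with h1 | h1
  · exact (hp ▸ h1).false
  · have h2 := h1.2
    rw [hk] at h2
    exact hlt.not_ge (h2 : n' ≤ k)

theorem le_of_pt_subset_cut (hd : d ∈ D) (hdΛ : d < Λ) {e : Ordinal.{u}} (h : IsProper α n)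
    (hs : (pt d α n : FinalSegments (BlowUp Λ D)).1 ⊆ (cut e).1) : e ≤ d := by
  rcases h.lt_or_lt with h | h
  · obtain ⟨p, hp, a, ha, hα⟩ := exists_left hd hdΛ h
    have := hs (mem_pt.2 (Or.inr ⟨hp, by rw [ha]; exact hα.ge⟩))
    exact hp ▸ mem_cut.1 this
  · obtain ⟨k, rfl⟩ := lt_omega0.1 h
    obtain ⟨p, hp, hk⟩ := exists_right hd hdΛ k
    have := hs (mem_pt.2 (Or.inr ⟨hp, by rw [hk]; exact le_refl (k : Ordinal)⟩))
    exact hp ▸ mem_cut.1 this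

theorem cut_subset_pt (hd : d ∈ D) (hdΛ : d < Λ) {e : Ordinal.{u}} (h : IsProper α n) :
    (cut e : FinalSegments (BlowUp Λ D)).1 ⊆ (pt d α n).1 ↔ d < e := by
  constructor
  · intro hs
    by_contra! hle
    rcases h.pos_or_pos with h | h
    · obtain ⟨p, hp, a, ha, hα⟩ := exists_left hd hdΛ (omega_pos 1)
      rcases mem_pt.1 (hs (mem_cut.2 (hle.trans hp.ge))) with h1 | h1
      · exact (hp ▸ h1).false
      · have h2 := h1.2
        rw [ha] at h2
        exact h.not_ge (hα ▸ (h2 : α ≤ tp a))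
    · obtain ⟨p, hp, hk⟩ := exists_right hd hdΛ 0
      rcases mem_pt.1 (hs (mem_cut.2 (hle.trans hp.ge))) with h1 | h1
      · exact (hp ▸ h1).false
      · have h2 := h1.2
        rw [hk] at h2
        exact h.not_ge ((h2 : n ≤ (0 : ℕ)).trans_eq Nat.cast_zero)
  · exact fun h p hp => Or.inl (h.trans_le (mem_cut.1 hp))

end Subset

/-- With `pt_zero`, this is why `IsProper` excludes the two extreme pairs: they give cuts. -/
theorem pt_omega (d : Ordinal.{u}) : (pt d ω₁ ω : FinalSegments (BlowUp Λ D)) = cut (d + 1) := by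
  refine FinalSegments.ext_iff.2 fun p => ?_
  rw [mem_pt, mem_cut, Order.add_one_le_iff, or_iff_left]
  rintro ⟨-, h⟩
  revert h
  rcases p.inner with a | m
  · exact fun h => (tp_lt a).not_ge h
  · exact fun h => (natCast_lt_omega0 m).not_ge h

theorem pt_zero (d : Ordinal.{u}) : (pt d 0 0 : FinalSegments (BlowUp Λ D)) = cut d := by
  refine FinalSegments.ext_iff.2 fun p => ?_
  have : InnerMem 0 0 p.inner := by
    rcases p.inner with a | m
    · exact bot_le (a := tp a)
    · exact bot_le (a := (m : Ordinal))
  rw [mem_pt, mem_cut, le_iff_lt_or_eq]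
  simp only [this, and_true, eq_comm]

/-- The classification of the final segments of `BlowUp Λ D`. -/
theorem eq_cut_or_eq_pt (F : FinalSegments (BlowUp Λ D)) :
    (∃ e ≤ Λ, F = cut e) ∨
      ∃ d ∈ D, d < Λ ∧ ∃ α n, IsProper α n ∧ F = pt d α n := by
  rcases F.1.eq_empty_or_nonempty with h | h
  · refine Or.inl ⟨Λ, le_rfl, FinalSegments.ext_iff.2 fun p => ?_⟩
    rw [h, mem_cut]
    simp [p.pos_lt]
  · obtain ⟨p₀, hp₀F, hp₀⟩ := csInf_mem (h.image pos)
    have hmin : ∀ q ∈ F.1, p₀.pos ≤ q.pos := fun q hq => by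
      rw [hp₀]
      exact csInf_le' (mem_image_of_mem pos hq)
    have hgt : ∀ q : BlowUp Λ D, p₀.pos < q.pos → q ∈ F.1 := fun q hq =>
      F.2 p₀ q hp₀F (le_iff.2 (Or.inl hq))
    set d := p₀.pos with hd
    have hdΛ : d < Λ := p₀.pos_lt
    by_cases hD : d ∈ D
    -- The extra members `ω₁` and `ω` encode the absence of left or right elements and keep the
    -- infimum from defaulting to `0`.
    · let SA : Set Ordinal.{0} := {α | α = ω₁ ∨ ∃ p ∈ F.1, p.pos = d ∧ ∃ a, p.inner = Sum.inl a ∧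
        tp a = α}
      let SN : Set Ordinal.{0} := {n | n = ω ∨ ∃ p ∈ F.1, p.pos = d ∧ ∃ m : ℕ, p.inner = Sum.inr m ∧
        (m : Ordinal) = n}
      have hA : sInf SA ∈ SA := csInf_mem ⟨ω₁, Or.inl rfl⟩
      have hN : sInf SN ∈ SN := csInf_mem ⟨ω, Or.inl rfl⟩
      have hA1 : sInf SA ≤ ω₁ := csInf_le' (Or.inl rfl)
      have hN1 : sInf SN ≤ ω := csInf_le' (Or.inl rfl)
      have hF : F = pt d (sInf SA) (sInf SN) := by
        refine FinalSegments.ext_iff.2 fun q => ?_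
        rw [mem_pt]
        constructor
        · intro hq
          rcases (hmin q hq).lt_or_eq with h1 | h1
          · exact Or.inl h1
          · refine Or.inr ⟨h1.symm, ?_⟩
            rcases hi : q.inner with a | m
            · exact (csInf_le' (Or.inr ⟨q, hq, h1.symm, a, hi, rfl⟩) : sInf SA ≤ tp a)
            · exact (csInf_le' (Or.inr ⟨q, hq, h1.symm, m, hi, rfl⟩) : sInf SN ≤ m)
        · rintro (h1 | ⟨h1, h2⟩)
          · exact hgt q h1
          · rcases hi : q.inner with a | m
            · rw [hi] at h2
              replace h2 : sInf SA ≤ tp a := h2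
              rcases hA with h3 | ⟨p, hp, hpd, b, hb, hb'⟩
              · exact absurd (h3.ge.trans h2) (tp_lt a).not_ge
              · refine F.2 p q hp (le_iff.2 (Or.inr ⟨hpd.trans h1.symm, ?_⟩))
                rw [hb, hi, Sum.inl_le_inl_iff, ← tp_le_tp, hb']
                exact h2
            · rw [hi] at h2
              replace h2 : sInf SN ≤ m := h2
              rcases hN with h3 | ⟨p, hp, hpd, b, hb, hb'⟩
              · exact absurd (h3.ge.trans h2) (natCast_lt_omega0 m).not_ge
              · refine F.2 p q hp (le_iff.2 (Or.inr ⟨hpd.trans h1.symm, ?_⟩))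
                rw [hb, hi, Sum.inr_le_inr_iff, ← Nat.cast_le (α := Ordinal.{0}), hb']
                exact h2
      have hlt : sInf SA < ω₁ ∨ sInf SN < ω := by
        rcases hi : p₀.inner with a | m
        · have h1 : sInf SA ≤ tp a := csInf_le' (Or.inr ⟨p₀, hp₀F, rfl, a, hi, rfl⟩)
          exact Or.inl (h1.trans_lt (tp_lt a))
        · have h1 : sInf SN ≤ m := csInf_le' (Or.inr ⟨p₀, hp₀F, rfl, m, hi, rfl⟩)
          exact Or.inr (h1.trans_lt (natCast_lt_omega0 m))
      by_cases h0 : 0 < sInf SA ∨ 0 < sInf SN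
      · exact Or.inr ⟨d, hD, hdΛ, _, _, ⟨hA1, hN1, hlt, h0⟩, hF⟩
      · rw [not_or, not_lt, not_lt, nonpos_iff_eq_zero, nonpos_iff_eq_zero] at h0
        rw [h0.1, h0.2, pt_zero] at hF
        exact Or.inl ⟨d, hdΛ.le, hF⟩
    · refine Or.inl ⟨d, hdΛ.le, FinalSegments.ext_iff.2 fun q => ⟨hmin q, fun hq => ?_⟩⟩
      rcases (mem_cut.1 hq).lt_or_eq with h1 | h1
      · exact hgt q h1
      · obtain ⟨a, ha, ha'⟩ := p₀.mem_or_inner.resolve_left hD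
        obtain ⟨b, hb, hb'⟩ := q.mem_or_inner.resolve_left (h1 ▸ hD)
        refine F.2 p₀ q hp₀F (le_iff.2 (Or.inr ⟨h1, ?_⟩))
        rw [ha, hb, Sum.inl_le_inl_iff, ← tp_le_tp, ha', hb']

/-! #### Neighbourhoods -/

theorem continuous_cut : Continuous (cut : Ordinal.{u} → FinalSegments (BlowUp Λ D)) := by
  refine FinalSegments.continuous_of_isClopen fun p => ?_
  have h : {e : Ordinal.{u} | p ∈ (cut e : FinalSegments (BlowUp Λ D)).1} = Iio (p.pos + 1) := by
    ext e
    rw [mem_Iio, Order.lt_add_one_iff]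
    exact Iff.rfl
  have h' : {e : Ordinal.{u} | p ∈ (cut e : FinalSegments (BlowUp Λ D)).1} = Iic p.pos := rfl
  exact ⟨h' ▸ isClosed_Iic, h ▸ isOpen_Iio⟩

theorem isClopen_superset (F : FinalSegments (BlowUp Λ D)) :
    IsClopen {G : FinalSegments (BlowUp Λ D) | F.1 ⊆ G.1} :=
  FinalSegments.isClopen_superset (isUnionOfTwoWellOrders Λ D) F

theorem eq_cut_zero_of_subset {G : FinalSegments (BlowUp Λ D)}
    (h : (cut 0 : FinalSegments (BlowUp Λ D)).1 ⊆ G.1) : G = cut 0 :=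
  FinalSegments.ext_iff.2 fun p => ⟨fun _ => bot_le (a := p.pos), fun hp => h hp⟩

/-- Inclusion reverses the order of places, so the neighbourhood consists of the final segments that
contain `cut e` but not `cut b`. -/
theorem exists_nhds_cut {b e : Ordinal.{u}} (hb : b < e) (he : e ≤ Λ) :
    ∃ U : Set (FinalSegments (BlowUp Λ D)), IsClopen U ∧ cut e ∈ U ∧ ∀ G ∈ U,
      (∃ e', b < e' ∧ e' ≤ e ∧ G = cut e') ∨
        ∃ d ∈ D, b ≤ d ∧ d < e ∧ ∃ α n, IsProper α n ∧ G = pt d α n := by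
  refine ⟨{G | (cut e).1 ⊆ G.1} ∩ {G | (cut b).1 ⊆ G.1}ᶜ,
    (isClopen_superset _).inter (isClopen_superset _).compl, ⟨Subset.rfl, ?_⟩, ?_⟩
  · exact fun h => hb.not_ge ((cut_subset_cut he).1 h)
  · rintro G ⟨h1, h2⟩
    rcases eq_cut_or_eq_pt G with ⟨e', he', rfl⟩ | ⟨d, hd, hdΛ, α, n, hp, rfl⟩
    · refine Or.inl ⟨e', ?_, (cut_subset_cut he').1 h1, rfl⟩
      by_contra! hle
      exact h2 ((cut_subset_cut he').2 hle)
    · refine Or.inr ⟨d, hd, ?_, (cut_subset_pt hd hdΛ hp).1 h1, α, n, hp, rfl⟩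
      by_contra! hlt
      exact h2 ((cut_subset_pt hd hdΛ hp).2 hlt)

theorem exists_nhds_pt {d : Ordinal.{u}} (hd : d ∈ D) (hdΛ : d < Λ) {α n : Ordinal.{0}}
    (hp : IsProper α n) :
    ∃ U : Set (FinalSegments (BlowUp Λ D)), IsClopen U ∧ pt d α n ∈ U ∧ ∀ G ∈ U,
      ∃ α' n', IsProper α' n' ∧ α' ≤ α ∧ n' ≤ n ∧ G = pt d α' n' := by
  refine ⟨{G | (pt d α n).1 ⊆ G.1} ∩ {G | (cut d).1 ⊆ G.1}ᶜ,
    (isClopen_superset _).inter (isClopen_superset _).compl, ⟨Subset.rfl, ?_⟩, ?_⟩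
  · exact fun h => ((cut_subset_pt hd hdΛ hp).1 h).false
  · rintro G ⟨h1, h2⟩
    rcases eq_cut_or_eq_pt G with ⟨e', he', rfl⟩ | ⟨d', hd', hdΛ', α', n', hp', rfl⟩
    · exact absurd ((cut_subset_cut he').2 (le_of_pt_subset_cut hd hdΛ hp h1)) h2
    · have h3 := le_of_pt_subset hd hdΛ hp h1
      rcases h3.lt_or_eq with h4 | rfl
      · exact absurd ((cut_subset_pt hd' hdΛ' hp').2 h4) h2
      · exact ⟨α', n', hp', left_le_of_pt_subset hd hdΛ hp'.left_le h1,
          right_le_of_pt_subset hd hdΛ hp'.right_le h1, rfl⟩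

/-- For `n = k + 1`, excluding the right element `k` fixes the second coordinate, which leaves part
of one row of the plank. -/
theorem exists_nhds_pt_of_lt {d : Ordinal.{u}} (hd : d ∈ D) (hdΛ : d < Λ) {α n : Ordinal.{0}}
    (hp : IsProper α n) (hn : n < ω) :
    ∃ U : Set (FinalSegments (BlowUp Λ D)), IsClopen U ∧ pt d α n ∈ U ∧ ∀ G ∈ U,
      ∃ α', IsProper α' n ∧ α' ≤ α ∧ G = pt d α' n := by
  obtain ⟨U, hU, hmem, h⟩ := exists_nhds_pt hd hdΛ hp
  obtain ⟨k, rfl⟩ := lt_omega0.1 hn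
  cases k with
  | zero =>
    refine ⟨U, hU, hmem, fun G hG => ?_⟩
    obtain ⟨α', n', hp', hα, hn', rfl⟩ := h G hG
    obtain rfl : n' = (0 : ℕ) := le_antisymm hn' (by simp)
    exact ⟨α', hp', hα, rfl⟩
  | succ k =>
    obtain ⟨p, hpd, hpk⟩ := exists_right hd hdΛ k
    refine ⟨U ∩ {G | p ∈ G.1}ᶜ, hU.inter (FinalSegments.isClopen_mem p).compl, ⟨hmem, ?_⟩, ?_⟩
    · intro hmem'
      rcases mem_pt.1 hmem' with h1 | ⟨-, h1⟩
      · exact (hpd ▸ h1).false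
      · rw [hpk] at h1
        exact absurd (Nat.cast_le.1 (h1 : ((k + 1 : ℕ) : Ordinal) ≤ k)) (by simp)
    · rintro G ⟨hG, hG'⟩
      obtain ⟨α', n', hp', hα, hn', rfl⟩ := h G hG
      obtain rfl : n' = (k + 1 : ℕ) := by
        refine le_antisymm hn' ?_
        by_contra! hlt
        refine hG' (mem_pt.2 (Or.inr ⟨hpd, ?_⟩))
        rw [hpk]
        have : n' < (k : Ordinal) + 1 := by exact_mod_cast hlt
        exact Order.lt_add_one_iff.1 this
      exact ⟨α', hp', hα, rfl⟩

/-! #### Cantor–Bendixson ranks -/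

/-- Upper bounds for the Cantor–Bendixson ranks of the final segments of `BlowUp Λ D`. -/
inductive RankBound (Λ : Ordinal.{u}) (D : Set Ordinal.{u}) :
    FinalSegments (BlowUp Λ D) → Ordinal.{u} → Prop
  | cut {e : Ordinal.{u}} (he : e ≤ Λ) (h0 : e ≠ 0) :
      RankBound Λ D (cut e) (ω₁ + 1 + lastExp e)
  | zero : RankBound Λ D (BlowUp.cut 0) 0
  | limit {d : Ordinal.{u}} (hd : d ∈ D) (hdΛ : d < Λ) {α : Ordinal.{0}} (hp : IsProper α ω) :
      RankBound Λ D (pt d α ω) (Ordinal.lift.{u} α + 1)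
  | side {d : Ordinal.{u}} (hd : d ∈ D) (hdΛ : d < Λ) {α n : Ordinal.{0}} (hp : IsProper α n)
      (hn : n < ω) : RankBound Λ D (pt d α n) (Ordinal.lift.{u} α)

/-- Points inside planks have bounds at most `ω₁`, which is why the bounds for cuts start at `ω₁ +
1`. -/
theorem rankBound_pt {d : Ordinal.{u}} (hd : d ∈ D) (hdΛ : d < Λ) {α n : Ordinal.{0}}
    (hp : IsProper α n) : ∃ γ < ω₁ + 1, RankBound Λ D (pt d α n) γ := by
  rcases hp.right_le.lt_or_eq with hn | rfl
  · refine ⟨_, ?_, .side hd hdΛ hp hn⟩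
    rw [Order.lt_add_one_iff]
    have := Ordinal.lift_le.{u, 0}.2 hp.left_le
    simpa using this
  · refine ⟨_, ?_, .limit hd hdΛ hp⟩
    have h1 : α < ω₁ := hp.lt_or_lt.resolve_right (lt_irrefl _)
    have h2 : Ordinal.lift.{u} α < ω₁ := by
      have := Ordinal.lift_lt.{u, 0}.2 h1
      simpa using this
    exact Order.lt_add_one_iff.2 (Order.add_one_le_of_lt h2)

theorem exists_rankBound (F : FinalSegments (BlowUp Λ D)) : ∃ β, RankBound Λ D F β := by
  rcases eq_cut_or_eq_pt F with ⟨e, he, rfl⟩ | ⟨d, hd, hdΛ, α, n, hp, rfl⟩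
  · rcases eq_or_ne e 0 with rfl | h0
    · exact ⟨_, .zero⟩
    · exact ⟨_, .cut he h0⟩
  · obtain ⟨γ, -, h⟩ := rankBound_pt hd hdΛ hp
    exact ⟨γ, h⟩

theorem RankBound.exists_nhds (F : FinalSegments (BlowUp Λ D)) (β : Ordinal.{u})
    (h : RankBound Λ D F β) :
    ∃ U ∈ 𝓝 F, ∀ G ∈ U, G ≠ F → ∃ γ < β, RankBound Λ D G γ := by
  cases h with
  | @cut e he h0 =>
    obtain ⟨b, hb, hlt⟩ := exists_forall_lastExp_lt h0
    obtain ⟨U, hU, hmem, hU'⟩ := exists_nhds_cut (D := D) hb he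
    refine ⟨U, hU.isOpen.mem_nhds hmem, fun G hG hne => ?_⟩
    rcases hU' G hG with ⟨e', hbe', he', rfl⟩ | ⟨d, hd, -, hde, α, n, hp, rfl⟩
    · have hlt' : e' < e := lt_of_le_of_ne he' (by rintro rfl; exact hne rfl)
      exact ⟨_, add_lt_add_right (hlt e' hbe' hlt') _,
        .cut (he'.trans he) (bot_le.trans_lt hbe').ne'⟩
    · obtain ⟨γ, hγ, hR⟩ := rankBound_pt hd (hde.trans_le he) hp
      exact ⟨γ, hγ.trans_le le_self_add, hR⟩
  | zero =>
    exact ⟨_, (isClopen_superset (BlowUp.cut 0)).isOpen.mem_nhds Subset.rfl,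
      fun G hG hne => absurd (eq_cut_zero_of_subset hG) hne⟩
  | @limit d hd hdΛ α hp =>
    obtain ⟨U, hU, hmem, hU'⟩ := exists_nhds_pt hd hdΛ hp
    refine ⟨U, hU.isOpen.mem_nhds hmem, fun G hG hne => ?_⟩
    obtain ⟨α', n', hp', hα, hn, rfl⟩ := hU' G hG
    rcases hn.lt_or_eq with hn | rfl
    · exact ⟨_, Order.lt_add_one_iff.2 (Ordinal.lift_le.2 hα), .side hd hdΛ hp' hn⟩
    · have : α' < α := lt_of_le_of_ne hα (by rintro rfl; exact hne rfl)
      exact ⟨_, Order.lt_add_one_iff.2 (Order.add_one_le_of_lt (Ordinal.lift_lt.2 this)),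
        .limit hd hdΛ hp'⟩
  | @side d hd hdΛ α n hp hn =>
    obtain ⟨U, hU, hmem, hU'⟩ := exists_nhds_pt_of_lt hd hdΛ hp hn
    refine ⟨U, hU.isOpen.mem_nhds hmem, fun G hG hne => ?_⟩
    obtain ⟨α', hp', hα, rfl⟩ := hU' G hG
    have : α' < α := lt_of_le_of_ne hα (by rintro rfl; exact hne rfl)
    exact ⟨_, Ordinal.lift_lt.2 this, .side hd hdΛ hp' hn⟩

theorem isScattered (Λ : Ordinal.{u}) (D : Set Ordinal.{u}) :
    IsScattered (FinalSegments (BlowUp Λ D)) :=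
  isScattered_of_rank RankBound.exists_nhds exists_rankBound

theorem RankBound.notMem {F : FinalSegments (BlowUp Λ D)} {β : Ordinal.{u}}
    (h : RankBound Λ D F β) : F ∉ cbDerivative (FinalSegments (BlowUp Λ D)) (β + 1) :=
  notMem_cbDerivative_add_one RankBound.exists_nhds β F h

/-- The cuts form a copy of `Λ + 1`, so inserting planks cannot lower their ranks. -/
theorem cut_mem_cbDerivative (β : Ordinal.{u}) : ∀ e ≤ Λ, e ≠ 0 → β ≤ lastExp e →
    cut e ∈ cbDerivative (FinalSegments (BlowUp Λ D)) β := by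
  induction β using Ordinal.limitRecOn with
  | zero => exact fun e _ _ _ => by rw [cbDerivative_zero]; trivial
  | add_one β ih =>
    intro e he h0 hβ
    have hlt : β < lastExp e := (lt_add_one β).trans_le hβ
    refine mem_cbDerivative_add_one.2 ⟨mem_derivedSet_iff.2 fun U hU => ?_, ih e he h0 hlt.le⟩
    obtain ⟨b, hb, hsub⟩ := exists_Ioc_subset_of_mem_nhds
      (continuous_cut.continuousAt.preimage_mem_nhds hU) ⟨0, pos_iff_ne_zero.2 h0⟩
    obtain ⟨x, hbx, hxe, hx⟩ := exists_between_le_lastExp hlt hb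
    refine ⟨cut x, ⟨hsub ⟨hbx, hxe.le⟩,
      ih x (hxe.le.trans he) (bot_le.trans_lt hbx).ne' hx⟩, fun h => hxe.ne ?_⟩
    exact cut_injOn (hxe.le.trans he) he h
  | limit β hβ ih =>
    intro e he h0 hle
    exact (mem_cbDerivative_limit hβ).2 fun γ hγ => ih γ hγ e he h0 (hγ.le.trans hle)

/-- `ω₁ * ω` is additively principal, so the error term `ω₁ + 1` is absorbed and the two bounds on
the rank meet. -/
theorem omega_one_add_eq {a : Ordinal.{u}} (h : ω₁ * ω ≤ a) : ω₁ + 1 + a = a := by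
  have h1 : (ω₁ : Ordinal.{u}) + 1 ≤ ω₁ * 2 := by
    rw [← one_add_one_eq_two, mul_add, mul_one]
    exact add_le_add_right (Order.one_le_iff_pos.2 (omega_pos 1)) _
  have h2 : (ω₁ : Ordinal.{u}) + 1 < ω₁ * ω := by
    refine h1.trans_lt ((mul_lt_mul_iff_right₀ (omega_pos 1)).2 ?_)
    exact_mod_cast natCast_lt_omega0 2
  have h3 : IsPrincipal (· + ·) ((ω₁ : Ordinal.{u}) * ω) :=
    isPrincipal_add_mul_of_isPrincipal_add _ one_lt_omega0.ne' isPrincipal_add_omega0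
  exact h3.add_eq_right_of_le h2 h

theorem rankBound_cut {e : Ordinal.{u}} (he : e ≤ Λ) (h0 : e ≠ 0) (h : ω₁ * ω ≤ lastExp e) :
    RankBound Λ D (cut e) (lastExp e) := by
  have := RankBound.cut (D := D) he h0
  rwa [omega_one_add_eq h] at this

section Power

variable {r : Ordinal.{u}}

theorem rankBound_end (hr : ω₁ * ω ≤ r) : RankBound (ω ^ r) D (cut (ω ^ r)) r := by
  have := rankBound_cut (D := D) (le_refl (ω ^ r)) (opow_ne_zero r omega0_ne_zero)
    (by rwa [lastExp_opow])
  rwa [lastExp_opow] at this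

theorem end_mem_cbDerivative :
    cut (ω ^ r) ∈ cbDerivative (FinalSegments (BlowUp (ω ^ r) D)) r :=
  cut_mem_cbDerivative r _ le_rfl (opow_ne_zero r omega0_ne_zero) (lastExp_opow r).ge

theorem cbDerivative_eq_singleton (hr : ω₁ * ω ≤ r) :
    cbDerivative (FinalSegments (BlowUp (ω ^ r) D)) r = {cut (ω ^ r)} := by
  have h1 : ω₁ + 1 ≤ r := by
    conv_rhs => rw [← omega_one_add_eq hr]
    exact le_self_add
  have hlt : ∀ F : FinalSegments (BlowUp (ω ^ r) D), F ≠ cut (ω ^ r) →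
      ∃ γ < r, RankBound (ω ^ r) D F γ := by
    intro F hF
    rcases eq_cut_or_eq_pt F with ⟨e, he, rfl⟩ | ⟨d, hd, hdΛ, α, n, hp, rfl⟩
    · rcases eq_or_ne e 0 with rfl | h0
      · exact ⟨_, lt_of_lt_of_le (lt_of_lt_of_le zero_lt_one le_add_self) h1, .zero⟩
      · refine ⟨_, ?_, .cut he h0⟩
        rw [← omega_one_add_eq hr]
        exact add_lt_add_right
          (lastExp_lt h0 (lt_of_le_of_ne he (by rintro rfl; exact hF rfl))) _
    · obtain ⟨γ, hγ, h⟩ := rankBound_pt hd hdΛ hp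
      exact ⟨γ, hγ.trans_le h1, h⟩
  refine eq_singleton_iff_unique_mem.2 ⟨end_mem_cbDerivative, fun F hF => ?_⟩
  by_contra hne
  obtain ⟨γ, hγ, h⟩ := hlt F hne
  exact h.notMem (cbDerivative_antitone (Order.add_one_le_of_lt hγ) hF)

theorem cbRank_eq (hr : ω₁ * ω ≤ r) : cbRank (FinalSegments (BlowUp (ω ^ r) D)) = r := by
  have hmem : cbDerivative (FinalSegments (BlowUp (ω ^ r) D)) (r + 1) = ∅ := by
    refine eq_empty_of_forall_notMem fun F hF => ?_
    have h1 : F ∈ ({cut (ω ^ r)} : Set (FinalSegments (BlowUp (ω ^ r) D))) := by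
      rw [← cbDerivative_eq_singleton hr]
      exact cbDerivative_antitone (lt_add_one r).le hF
    rw [mem_singleton_iff] at h1
    subst h1
    exact (rankBound_end hr).notMem hF
  refine le_antisymm (csInf_le' hmem) (le_csInf ⟨r, hmem⟩ fun α hα => ?_)
  by_contra! hlt
  have := cbDerivative_antitone (Order.add_one_le_of_lt hlt) (end_mem_cbDerivative (D := D))
  rw [hα] at this
  exact this

theorem isEndPoint_end (hr : ω₁ * ω ≤ r) :
    IsEndPoint (cut (ω ^ r) : FinalSegments (BlowUp (ω ^ r) D)) := by
  rw [IsEndPoint, cbRank_eq hr, cbDerivative_eq_singleton hr]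

theorem eq_end_of_isEndPoint (hr : ω₁ * ω ≤ r) {x : FinalSegments (BlowUp (ω ^ r) D)}
    (hx : IsEndPoint x) :
    x = cut (ω ^ r) := by
  rw [IsEndPoint, cbRank_eq hr, cbDerivative_eq_singleton hr] at hx
  exact (singleton_injective hx).symm

theorem isUnitary (hr : ω₁ * ω ≤ r) : IsUnitary (FinalSegments (BlowUp (ω ^ r) D)) :=
  ⟨inferInstance, isScattered _ _, _, isEndPoint_end hr⟩

end Power

end BlowUp

namespace BlowUp

variable {Λ : Ordinal.{u}} {D : Set Ordinal.{u}}

/-! #### Planks in the space of final segments -/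

/-- The plank at the place `d`. -/
def plank (Λ : Ordinal.{u}) (D : Set Ordinal.{u}) (d : Ordinal.{u}) (t : TikhonovPlank) :
    FinalSegments (BlowUp Λ D) := pt d t.1 t.2

theorem isEmbedding_plank {d : Ordinal.{u}} (hd : d ∈ D) (hdΛ : d < Λ) :
    IsEmbedding (plank Λ D d) := by
  have hc : ∀ b : Ordinal.{0}, IsClopen (Iic b) := fun b => by
    refine ⟨isClosed_Iic, ?_⟩
    have : Iic b = Iio (b + 1) := by
      ext x
      simp
    rw [this]
    exact isOpen_Iio
  have c1 : Continuous fun t : TikhonovPlank => (t.1 : Ordinal) :=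
    continuous_subtype_val.comp continuous_fst
  have c2 : Continuous fun t : TikhonovPlank => (t.2 : Ordinal) :=
    continuous_subtype_val.comp continuous_snd
  refine (Continuous.isClosedEmbedding (FinalSegments.continuous_of_isClopen fun p => ?_)
    ?_).isEmbedding
  · by_cases h1 : d < p.pos
    · convert isClopen_univ
      exact eq_univ_of_forall fun t => Or.inl h1
    by_cases h2 : p.pos = d
    · have : {t | p ∈ (plank Λ D d t).1} = {t | InnerMem t.1 t.2 p.inner} := by
        ext t
        exact ⟨fun h => (h.resolve_left h1).2, fun h => Or.inr ⟨h2, h⟩⟩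
      rw [this]
      rcases p.inner with a | m
      · exact (hc (tp a)).preimage c1
      · exact (hc m).preimage c2
    · convert isClopen_empty
      refine eq_empty_of_forall_notMem fun t h => ?_
      exact (mem_pt.1 h).elim h1 fun h => h2 h.1
  · intro s t hst
    have h1 : (pt d s.1 s.2 : FinalSegments (BlowUp Λ D)).1 ⊆ (pt d t.1 t.2).1 :=
      (congrArg Subtype.val hst).subset
    have h2 : (pt d t.1 t.2 : FinalSegments (BlowUp Λ D)).1 ⊆ (pt d s.1 s.2).1 :=
      (congrArg Subtype.val hst).symm.subset
    exact Prod.ext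
      (Subtype.ext (le_antisymm (left_le_of_pt_subset hd hdΛ s.1.2 h2)
        (left_le_of_pt_subset hd hdΛ t.1.2 h1)))
      (Subtype.ext (le_antisymm (right_le_of_pt_subset hd hdΛ s.2.2 h2)
        (right_le_of_pt_subset hd hdΛ t.2.2 h1)))

theorem plank_corner (d : Ordinal.{u}) : plank Λ D d (TikhonovPlank.mk ω₁ ω) = cut (d + 1) := by
  rw [plank, TikhonovPlank.coe_fst_mk le_rfl, TikhonovPlank.coe_snd_mk le_rfl, pt_omega]

theorem cut_add_one_mem_plankPoints {d : Ordinal.{u}} (hd : d ∈ D) (hdΛ : d < Λ) :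
    cut (d + 1) ∈ plankPoints (FinalSegments (BlowUp Λ D)) := by
  intro U hU
  have he := isEmbedding_plank hd hdΛ
  rw [← plank_corner] at hU
  exact ((TikhonovPlank.containsTikhonovPlank_of_mem_nhds
    (he.continuous.continuousAt.preimage_mem_nhds hU)).image he).mono (image_preimage_subset _ _)

theorem countable_Iic_of_lt {α : Ordinal.{0}} (h : α < ω₁) : (Iic α).Countable := by
  have h1 : α + 1 < ω₁ := (isSuccLimit_omega 1).add_one_lt h
  have h2 : Iic α = Iio (α + 1) := by
    ext x
    simp
  rw [h2, ← le_aleph0_iff_set_countable, Cardinal.mk_Iio_ordinal, lift_le_aleph0,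
    ← Order.lt_succ_iff, succ_aleph0]
  rwa [← ord_aleph, lt_ord] at h1

/-- Properness leaves two cases: for `α < ω₁` there is a countable neighbourhood, and for `n < ω`
one inside a row, which is a chain. -/
theorem notMem_plankPoints_pt {d : Ordinal.{u}} (hd : d ∈ D) (hdΛ : d < Λ) {α n : Ordinal.{0}}
    (hp : IsProper α n) : pt d α n ∉ plankPoints (FinalSegments (BlowUp Λ D)) := by
  intro hmem
  rcases hp.lt_or_lt with h | h
  · obtain ⟨U, hU, hpU, hU'⟩ := exists_nhds_pt hd hdΛ hp
    refine not_containsTikhonovPlank_of_countable ?_ (hmem U (hU.isOpen.mem_nhds hpU))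
    have hω : (Iic (ω : Ordinal.{0})).Countable := countable_Iic_of_lt omega0_lt_omega_one
    refine (((countable_Iic_of_lt h).prod hω).image
      (fun z : Ordinal.{0} × Ordinal.{0} => (pt d z.1 z.2 : FinalSegments (BlowUp Λ D)))).mono ?_
    intro G hG
    obtain ⟨α', n', hp', hα, -, rfl⟩ := hU' G hG
    exact ⟨(α', n'), ⟨hα, hp'.right_le⟩, rfl⟩
  · obtain ⟨U, hU, hpU, hU'⟩ := exists_nhds_pt_of_lt hd hdΛ hp h
    refine FinalSegments.not_containsTikhonovPlank_of_isChain hU.isClosed ?_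
      (hmem U (hU.isOpen.mem_nhds hpU))
    intro F hF G hG
    obtain ⟨α₁, -, -, rfl⟩ := hU' F hF
    obtain ⟨α₂, -, -, rfl⟩ := hU' G hG
    have key : ∀ β γ : Ordinal.{0}, β ≤ γ →
        (pt d γ n : FinalSegments (BlowUp Λ D)).1 ⊆ (pt d β n).1 := by
      intro β γ hβγ p hp
      refine (mem_pt.1 hp).imp_right fun h => ⟨h.1, ?_⟩
      have h2 := h.2
      revert h2
      rcases p.inner with a | m
      · exact fun h2 => hβγ.trans h2
      · exact id
    exact (le_total α₂ α₁).imp (key _ _) (key _ _)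

theorem plankPoints_eq (hD : ∀ d ∈ D, d < Λ) :
    plankPoints (FinalSegments (BlowUp Λ D)) = cut '' closure ((· + 1) '' D) := by
  refine Subset.antisymm (fun x hx => ?_) ?_
  · rcases eq_cut_or_eq_pt x with ⟨e, he, rfl⟩ | ⟨d, hd, hdΛ, α, n, hp, rfl⟩
    · refine mem_image_of_mem _ ?_
      by_contra hcl
      rcases eq_or_ne e 0 with rfl | h0
      · refine FinalSegments.not_containsTikhonovPlank_of_isChain
          (isClopen_superset (cut 0)).isClosed ?_
          (hx _ ((isClopen_superset (cut 0)).isOpen.mem_nhds Subset.rfl))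
        intro F hF G hG
        rw [eq_cut_zero_of_subset hF, eq_cut_zero_of_subset hG]
        exact Or.inl Subset.rfl
      · obtain ⟨b, hb, hsub⟩ := exists_Ioc_subset_of_mem_nhds
          (isClosed_closure.isOpen_compl.mem_nhds hcl) ⟨0, pos_iff_ne_zero.2 h0⟩
        obtain ⟨U, hU, hmem, hU'⟩ := exists_nhds_cut (D := D) hb he
        refine FinalSegments.not_containsTikhonovPlank_of_isChain hU.isClosed ?_
          (hx U (hU.isOpen.mem_nhds hmem))
        -- A place `d ∈ D` with `b ≤ d < e` would put `d + 1` into `Ioc b e`, which misses the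
        -- closure; so the neighbourhood consists of cuts alone.
        have key : ∀ G ∈ U, ∃ e' ≤ Λ, G = cut e' := by
          intro G hG
          rcases hU' G hG with ⟨e', -, he', rfl⟩ | ⟨d, hd, hbd, hde, -⟩
          · exact ⟨e', he'.trans he, rfl⟩
          · exact absurd (subset_closure (mem_image_of_mem _ hd))
              (hsub ⟨Order.lt_add_one_iff.2 hbd, Order.add_one_le_of_lt hde⟩)
        intro F hF G hG
        obtain ⟨e₁, h₁, rfl⟩ := key F hF
        obtain ⟨e₂, h₂, rfl⟩ := key G hG
        rw [cut_subset_cut h₁, cut_subset_cut h₂]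
        exact (le_total e₁ e₂).symm
    · exact absurd hx (notMem_plankPoints_pt hd hdΛ hp)
  · rw [image_subset_iff]
    refine closure_minimal ?_ ((isClosed_plankPoints _).preimage continuous_cut)
    rintro _ ⟨d, hd, rfl⟩
    exact cut_add_one_mem_plankPoints hd (hD d hd)

/-- On the compact set `Iic Λ` the map `cut` is continuous and injective, so limits may be computed
among the ordinals. -/
theorem derivedSet_image_cut {E : Set Ordinal.{u}} (hE : E ⊆ Iic Λ) :
    derivedSet (cut '' E : Set (FinalSegments (BlowUp Λ D))) = cut '' derivedSet E := by
  refine Subset.antisymm (fun x hx => ?_) ?_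
  · have hcl : IsClosed (cut '' Iic Λ : Set (FinalSegments (BlowUp Λ D))) := by
      rw [← Icc_bot]
      exact (isCompact_Icc.image continuous_cut).isClosed
    obtain ⟨e, he, rfl⟩ := closure_minimal (image_mono hE) hcl (derivedSet_subset_closure _ hx)
    refine mem_image_of_mem _ (mem_derivedSet_ordinal.2 ⟨?_, fun b hb => ?_⟩)
    · rintro rfl
      obtain ⟨y, ⟨hy, -⟩, hne⟩ := mem_derivedSet_iff.1 hx _
        ((isClopen_superset (cut 0)).isOpen.mem_nhds Subset.rfl)
      exact hne (eq_cut_zero_of_subset hy)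
    · obtain ⟨y, ⟨⟨hy1, hy2⟩, x, hxE, rfl⟩, hne⟩ := mem_derivedSet_iff.1 hx _
        (((isClopen_superset (cut e)).inter (isClopen_superset (cut b)).compl).isOpen.mem_nhds
          ⟨Subset.rfl, fun h => hb.not_ge ((cut_subset_cut he).1 h)⟩)
      refine ⟨x, hxE, ?_, lt_of_le_of_ne ((cut_subset_cut (hE hxE)).1 hy1) ?_⟩
      · by_contra! hle
        exact hy2 ((cut_subset_cut (hE hxE)).2 hle)
      · rintro rfl
        exact hne rfl
  · rintro _ ⟨e, he, rfl⟩
    refine mem_derivedSet_iff.2 fun U hU => ?_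
    obtain ⟨y, ⟨hyU, hyE⟩, hne⟩ := mem_derivedSet_iff.1 he _
      (continuous_cut.continuousAt.preimage_mem_nhds hU)
    have heΛ : e ≤ Λ := closure_minimal hE isClosed_Iic (derivedSet_subset_closure _ he)
    exact ⟨cut y, ⟨hyU, y, hyE, rfl⟩, fun h => hne (cut_injOn (hE hyE) heΛ h)⟩

theorem derivedSet_plankPoints (hD : ∀ d ∈ D, d < Λ) :
    derivedSet (plankPoints (FinalSegments (BlowUp Λ D))) =
      cut '' derivedSet ((· + 1) '' D) := by
  have h : (· + 1) '' D ⊆ Iic Λ := by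
    rintro _ ⟨d, hd, rfl⟩
    exact Order.add_one_le_of_lt (hD d hd)
  rw [plankPoints_eq hD, derivedSet_image_cut (closure_minimal h isClosed_Iic), derivedSet_closure]

theorem derivedSet_derivedSet_plankPoints (hD : ∀ d ∈ D, d < Λ) :
    derivedSet (derivedSet (plankPoints (FinalSegments (BlowUp Λ D)))) =
      cut '' derivedSet (derivedSet ((· + 1) '' D)) := by
  have h : (· + 1) '' D ⊆ Iic Λ := by
    rintro _ ⟨d, hd, rfl⟩
    exact Order.add_one_le_of_lt (hD d hd)
  rw [derivedSet_plankPoints hD, derivedSet_image_cut]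
  exact (derivedSet_subset_closure _).trans (closure_minimal h isClosed_Iic)

/-! #### The ranks of the simple limits of planks -/

section Sparse

variable {A : Set Ordinal.{u}} {g : Ordinal.{u} → Ordinal.{u}} {r : Ordinal.{u}}

theorem opow_add_opow_lt_of_mem (hg : ∀ a ∈ A, g a < a) (hA : ∀ a ∈ A, a < r)
    {a : Ordinal.{u}} (ha : a ∈ A) : ω ^ a + ω ^ (g a + 1) < ω ^ r :=
  (opow_add_opow_lt (hg a ha)).trans_le
    (opow_le_opow_right omega0_pos (Order.add_one_le_of_lt (hA a ha)))

theorem mem_cbDerivative_cut_iff (hg : ∀ a ∈ A, g a < a) (hA : ∀ a ∈ A, a < r)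
    (hc : ∀ a ∈ A, ω₁ * ω ≤ g a) {a : Ordinal.{u}} (ha : a ∈ A) {β : Ordinal.{u}} :
    cut (ω ^ a + ω ^ (g a + 1)) ∈ cbDerivative (FinalSegments (BlowUp (ω ^ r) D)) β ↔
      β ≤ g a + 1 := by
  have hle := (opow_add_opow_lt_of_mem hg hA ha).le
  have h0 : ω ^ a + ω ^ (g a + 1) ≠ 0 :=
    (lt_of_lt_of_le (opow_pos a omega0_pos) le_self_add).ne'
  have hv : lastExp (ω ^ a + ω ^ (g a + 1)) = g a + 1 :=
    lastExp_opow_add_opow (Order.add_one_le_of_lt (hg a ha))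
  constructor
  · intro h
    by_contra! hlt
    have hR := rankBound_cut (D := D) hle h0 (by
      rw [hv]
      exact (hc a ha).trans le_self_add)
    rw [hv] at hR
    exact hR.notMem (cbDerivative_antitone (Order.add_one_le_of_lt hlt) h)
  · exact fun h => cut_mem_cbDerivative β _ hle h0 (by rwa [hv])

theorem exists_of_mem_plankLimitRanks (hg : ∀ a ∈ A, g a < a) (hA : ∀ a ∈ A, a < r)
    (hc : ∀ a ∈ A, ω₁ * ω ≤ g a) {U : Set (FinalSegments (BlowUp (ω ^ r) (sparseSet A g)))}
    {α : Ordinal.{u}} (hα : α ∈ plankLimitRanks U) : ∃ a ∈ A, α = g a + 1 := by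
  obtain ⟨x, -, hx1, hx2, hx3, hx4⟩ := hα
  have hD : ∀ d ∈ sparseSet A g, d < ω ^ r := fun d hd => lt_of_mem_sparseSet hg hA hd
  rw [derivedSet_plankPoints hD] at hx1
  rw [derivedSet_derivedSet_plankPoints hD] at hx2
  obtain ⟨e, he, rfl⟩ := hx1
  obtain ⟨a, ha, rfl⟩ := exists_eq_of_mem_derivedSet_sparseSet hg he
    fun h => hx2 (mem_image_of_mem _ h)
  rw [mem_cbDerivative_cut_iff hg hA hc ha] at hx3 hx4
  exact ⟨a, ha, le_antisymm hx3 (Order.lt_add_one_iff.1 (not_le.1 hx4))⟩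

theorem exists_mem_of_mem_nhds_end (hrl : Order.IsSuccLimit r)
    {U : Set (FinalSegments (BlowUp (ω ^ r) D))} (hU : U ∈ 𝓝 (cut (ω ^ r))) {s : Set Ordinal.{u}}
    (hs : ∀ b < r, ∃ a ∈ s, b ≤ a) : ∃ a ∈ s, ∀ e, ω ^ a < e → e < ω ^ r → cut e ∈ U := by
  obtain ⟨b, hb, hsub⟩ := exists_Ioc_subset_of_mem_nhds
    (continuous_cut.continuousAt.preimage_mem_nhds hU) ⟨0, opow_pos r omega0_pos⟩
  obtain ⟨b', hb', hlt⟩ := (lt_opow_of_isSuccLimit omega0_ne_zero hrl).1 hb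
  obtain ⟨a, ha, hba⟩ := hs b' hb'
  refine ⟨a, ha, fun e h1 h2 => hsub ⟨hlt.trans_le ?_ |>.trans h1, h2.le⟩⟩
  exact opow_le_opow_right omega0_pos hba

theorem mem_plankLimitRanks (hg : ∀ a ∈ A, g a < a) (hA : ∀ a ∈ A, a < r)
    (hc : ∀ a ∈ A, ω₁ * ω ≤ g a) (hrl : Order.IsSuccLimit r)
    {U : Set (FinalSegments (BlowUp (ω ^ r) (sparseSet A g)))} (hU : U ∈ 𝓝 (cut (ω ^ r)))
    {c : Ordinal.{u}} (hcof : ∀ b < r, ∃ a ∈ {a | a ∈ A ∧ g a = c}, b ≤ a) :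
    c + 1 ∈ plankLimitRanks U := by
  have hD : ∀ d ∈ sparseSet A g, d < ω ^ r := fun d hd => lt_of_mem_sparseSet hg hA hd
  obtain ⟨a, ⟨ha, rfl⟩, h⟩ := exists_mem_of_mem_nhds_end hrl hU hcof
  refine ⟨cut (ω ^ a + ω ^ (g a + 1)), h _ (lt_add_of_pos_right _ (opow_pos _ omega0_pos))
    (opow_add_opow_lt_of_mem hg hA ha), ?_, ?_, ?_, ?_⟩
  · rw [derivedSet_plankPoints hD]
    exact mem_image_of_mem _ (mem_derivedSet_sparseSet ha)
  · rw [derivedSet_derivedSet_plankPoints hD]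
    rintro ⟨e, he, heq⟩
    have hsub : derivedSet (derivedSet ((· + 1) '' sparseSet A g)) ⊆ Iic (ω ^ r) := by
      refine (derivedSet_subset_closure _).trans (closure_minimal
        ((derivedSet_subset_closure _).trans (closure_minimal ?_ isClosed_Iic)) isClosed_Iic)
      rintro _ ⟨d, hd, rfl⟩
      exact Order.add_one_le_of_lt (hD d hd)
    have := cut_injOn (hsub he) (opow_add_opow_lt_of_mem hg hA ha).le heq
    subst this
    exact notMem_derivedSet_derivedSet_sparseSet hg ha he
  · exact (mem_cbDerivative_cut_iff hg hA hc ha).2 le_rfl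
  · rw [mem_cbDerivative_cut_iff hg hA hc ha]
    exact (lt_add_one _).not_ge

theorem containsTikhonovPlank_of_mem_nhds (hg : ∀ a ∈ A, g a < a) (hA : ∀ a ∈ A, a < r)
    (hrl : Order.IsSuccLimit r)
    {U : Set (FinalSegments (BlowUp (ω ^ r) (sparseSet A g)))} (hU : U ∈ 𝓝 (cut (ω ^ r)))
    (hcof : ∀ b < r, ∃ a ∈ A, b ≤ a) : ContainsTikhonovPlank U := by
  obtain ⟨V, hVU, hV, hmem⟩ := mem_nhds_iff.1 hU
  obtain ⟨a, ha, h⟩ := exists_mem_of_mem_nhds_end hrl (hV.mem_nhds hmem) hcof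
  -- The first member of the cluster, `n = 0`, already provides a plank with its corner in the
  -- neighbourhood.
  have hdD : ω ^ a ∈ sparseSet A g := ⟨a, ha, 0, by simp⟩
  have hd := lt_of_mem_sparseSet hg hA hdD
  have hlim : Order.IsSuccLimit (ω ^ r : Ordinal.{u}) :=
    isSuccLimit_opow one_lt_omega0 hrl
  exact (cut_add_one_mem_plankPoints hdD hd V
    (hV.mem_nhds (h _ (lt_add_one _) (hlim.add_one_lt hd)))).mono hVU

end Sparse

/-! #### Cardinality -/

theorem mk_eq {κ : Cardinal.{u}} (hκ : ℵ₀ < κ) (hΛ : Λ.card = κ) : #(BlowUp Λ D) = κ := by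
  have h1 : #Λ.ToType = κ := by rw [mk_toType, hΛ]
  refine le_antisymm ?_ ?_
  · refine (mk_subtype_le _).trans ?_
    rw [show #(Λ.ToType ×ₗ ((ω₁ : Ordinal.{0}).ToType ⊕ ℕ)) =
      #(Λ.ToType × ((ω₁ : Ordinal.{0}).ToType ⊕ ℕ)) from rfl]
    rw [mk_prod, h1]
    refine mul_le_of_le hκ.le ?_ ?_
    · simp
    · have h2 : ℵ₁ ≤ κ := by
        rw [← succ_aleph0]
        exact Order.succ_le_of_lt hκ
      simp only [mk_sum, mk_toType, card_omega, Cardinal.lift_add, lift_aleph, mk_nat,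
        lift_aleph0, Ordinal.lift_one]
      exact add_le_of_le hκ.le h2 hκ.le
  · choose f hf hf' using fun w : Λ.ToType => exists_base (D := D) (tp_lt w)
    rw [← h1]
    refine mk_le_of_injective (f := f) fun v w h => tp_injective ?_
    rw [← hf v, ← hf w, h]

end BlowUp

/-! ### The ordinals `r(κ)` -/

theorem ord_aleph_one : (ℵ₁ : Cardinal.{u}).ord = ω₁ := ord_aleph 1

/-- Successor steps are closed off by the uncountable cofinality of `c`, and limit steps are suprema
of fewer than `c.cof` terms. -/
theorem deriv_lt_of_lt_cof {c : Ordinal.{u}} (hc : ℵ₀ < c.cof) (hreg : ∀ o < c, o.card < c.cof)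
    (hlim : Order.IsSuccLimit c) {f : Ordinal.{u} → Ordinal.{u}} (hf : ∀ i < c, f i < c)
    (o : Ordinal.{u}) : o < c → deriv f o < c := by
  induction o using Ordinal.limitRecOn with
  | zero =>
    intro h
    rw [deriv_zero_right]
    exact nfp_lt_ord hc hf h
  | add_one o ih =>
    intro h
    rw [deriv_add_one]
    exact nfp_lt_ord hc hf (hlim.add_one_lt (ih ((lt_add_one o).trans h)))
  | limit o ho ih =>
    intro h
    rw [deriv_limit f ho]
    refine lift_iSup_lt_of_lt_cof ?_ fun a => ih a a.2 (a.2.trans h)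
    have h1 : #{a : Ordinal.{u} // a < o} = Cardinal.lift.{u + 1} o.card :=
      Cardinal.mk_Iio_ordinal o
    rw [h1, ← lift_cof, Cardinal.lift_lift, Cardinal.lift_umax.{u, u + 1}]
    exact Cardinal.lift_lt.2 (hreg o h)

theorem cof_omega_one : (ω₁ : Ordinal.{u}).cof = ℵ₁ := by
  rw [← ord_aleph_one, isRegular_aleph_one.cof_ord]

theorem cof_omega_two : (ω_ 2 : Ordinal.{u}).cof = ℵ_ 2 := by
  have h : Cardinal.IsRegular (ℵ_ 2 : Cardinal.{u}) := by
    have := isRegular_aleph_add_one (1 : Ordinal.{u})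
    rwa [one_add_one_eq_two] at this
  rw [← ord_aleph, h.cof_ord]

/-- The witness is the fixed point of `ω ^ ·` with index `ω₁ + ω₁`: a limit index of cofinality `ω₁`
passes its cofinality on, and an index beyond `ω₁` puts the value beyond `ω₁`. -/
theorem exists_mem_setE : ∃ θ ∈ setE.{u}, ω₁ < θ := by
  have h12 : (ω₁ : Ordinal.{u}) < ω_ 2 := omega_lt_omega.2 one_lt_two
  have hlim : Order.IsSuccLimit (ω₁ + ω₁ : Ordinal.{u}) := isSuccLimit_add _ (isSuccLimit_omega 1)
  have hn := isNormal_deriv (fun a : Ordinal.{u} => ω ^ a)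
  have hlt : (ω₁ + ω₁ : Ordinal.{u}) < ω_ 2 := isPrincipal_add_omega 2 h12 h12
  refine ⟨deriv (fun a => ω ^ a) (ω₁ + ω₁), ⟨?_, ?_, ?_⟩, ?_⟩
  · refine deriv_lt_of_lt_cof ?_ ?_ (isSuccLimit_omega 2) ?_ _ hlt
    · rw [cof_omega_two, ← aleph_zero]
      exact aleph_lt_aleph.2 two_pos
    · intro o ho
      rw [cof_omega_two]
      rwa [← ord_aleph, lt_ord] at ho
    · exact fun i hi => isPrincipal_opow_omega 2 (omega0_lt_omega_one.trans h12) hi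
  · exact deriv_fp (isNormal_opow one_lt_omega0) _
  · rw [cof_map_of_isNormal hn hlim, cof_add _ (omega_pos 1).ne', cof_omega_one]
  · exact (lt_add_of_pos_right _ (omega_pos 1)).trans_le hn.strictMono.le_apply

/-- By cofinality no member of `setE` is below `ω₁`. So the least member above `ω₁` has at most one
predecessor in `setE`, and being a fixed point of `ω ^ ·` it exceeds `ω₁ * ω`. -/
theorem exists_mem_setE₀ : ∃ θ ∈ setE₀.{u}, ω₁ * ω ≤ θ := by
  have hne : {θ | θ ∈ setE.{u} ∧ ω₁ < θ}.Nonempty := exists_mem_setE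
  set θ := sInf {θ | θ ∈ setE.{u} ∧ ω₁ < θ} with hθ
  obtain ⟨hE, hlt⟩ : θ ∈ setE.{u} ∧ ω₁ < θ := csInf_mem hne
  refine ⟨θ, ⟨hE, ?_⟩, ?_⟩
  · have hsub : ∀ η : {η : Ordinal.{u} // η ∈ setE ∧ η < θ}, η.1 = ω₁ := by
      rintro ⟨η, hη, hηθ⟩
      refine le_antisymm ?_ ?_
      · by_contra! h
        exact notMem_of_lt_csInf' hηθ ⟨hη, h⟩
      · have := ord_cof_le η
        rwa [hη.2.2, ord_aleph_one] at this
    have : Subsingleton {η : Ordinal.{u} // η ∈ setE ∧ η < θ} :=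
      ⟨fun a b => Subtype.ext ((hsub a).trans (hsub b).symm)⟩
    rw [← ord_aleph_one, lt_ord, card_type]
    exact (Cardinal.le_one_iff_subsingleton.2 this).trans_lt
      (one_lt_aleph0.trans aleph0_lt_aleph_one)
  · rw [← hE.2.1]
    calc ω₁ * ω ≤ ω ^ ω₁ * ω := mul_le_mul_left (right_le_opow _ one_lt_omega0) _
      _ = ω ^ (ω₁ + 1) := (opow_add_one _ _).symm
      _ ≤ ω ^ θ := opow_le_opow_right omega0_pos (Order.add_one_le_of_lt hlt)

theorem mk_setE₀_le : #(setE₀.{u}) ≤ ℵ₁ := by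
  have h : typeLT (setE₀.{u}) ≤ ω₁ := by
    refine le_of_forall_lt fun o ho => ?_
    obtain ⟨x, rfl⟩ := typein_surj (α := setE₀.{u}) (· < ·) ho
    refine lt_of_le_of_lt ?_ x.2.2
    refine RelEmbedding.ordinal_type_le (r := Subrel (· < ·) (fun y : setE₀.{u} => y < x))
      (s := ((· < ·) : {η : Ordinal.{u} // η ∈ setE ∧ η < x.1} → _ → Prop)) ?_
    exact ⟨⟨fun y => ⟨y.1.1, y.1.2.1, y.2⟩, fun a b hab =>
      Subtype.ext (Subtype.ext
        (congrArg (fun z : {η : Ordinal.{u} // η ∈ setE ∧ η < x.1} => z.1) hab))⟩, Iff.rfl⟩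
  have := card_le_card h
  rwa [card_type, card_omega] at this

theorem bddAbove_setE₀ : BddAbove setE₀.{u} := ⟨ω_ 2, fun _ h => h.1.1.le⟩

theorem sSup_setE₀_lt : sSup setE₀.{u} < ω_ 2 := by
  refine sSup_lt_of_lt_cof (mk_setE₀_le.trans_lt ?_) fun _ h => h.1.1
  rw [← lift_cof, cof_omega_two, lift_aleph]
  simp

/-- Of `rOrd κ` the construction needs only this final stretch of type `κ.ord`, the cardinality `κ`,
and room for `κ` codes above `ω₁ * ω`. -/
theorem rOrd_eq_add (κ : Cardinal.{u}) : ∃ r₀, rOrd κ = r₀ + κ.ord := by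
  unfold rOrd
  split_ifs with h1 h2
  · exact ⟨sSup setE₀, by rw [h1, ord_aleph_one]⟩
  · exact ⟨κ.ord, rfl⟩
  · exact ⟨0, (zero_add _).symm⟩

theorem card_rOrd {κ : Cardinal.{u}} (hκ : ℵ₀ < κ) : (rOrd κ).card = κ := by
  unfold rOrd
  split_ifs with h1 h2
  · have h : (sSup setE₀.{u}).card ≤ ℵ₁ := by
      have := sSup_setE₀_lt.{u}
      rw [← ord_aleph, lt_ord, ← one_add_one_eq_two, ← succ_aleph,
        Order.lt_succ_iff] at this
      exact this
    rw [card_add, card_omega, h1]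
    exact add_eq_right aleph0_lt_aleph_one.le h
  · rw [card_add, card_ord, add_eq_self hκ.le]
  · exact card_ord κ

theorem omega_one_mul_add_lt_rOrd {κ : Cardinal.{u}} (hκ : ℵ₀ < κ) {ζ : Ordinal.{u}}
    (hζ : ζ < κ.ord) : ω₁ * ω + ζ < rOrd κ := by
  by_cases h1 : κ = ℵ₁
  · rw [rOrd, if_pos h1]
    obtain ⟨θ, hθ, hle⟩ := exists_mem_setE₀.{u}
    rw [h1, ord_aleph_one] at hζ
    exact add_lt_add_of_le_of_lt (hle.trans (le_csSup bddAbove_setE₀ hθ)) hζ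
  · have h2 : ℵ₁ < κ := by
      refine lt_of_le_of_ne ?_ (Ne.symm h1)
      rw [← succ_aleph0]
      exact Order.succ_le_of_lt hκ
    have h3 : ω₁ < κ.ord := by
      rw [← ord_aleph_one]
      exact ord_lt_ord.2 h2
    have h4 : ω₁ * ω + ζ < κ.ord := isPrincipal_add_ord hκ.le
      (isPrincipal_mul_ord hκ.le h3 (omega0_lt_omega_one.trans h3)) hζ
    obtain ⟨r₀, hr₀⟩ := rOrd_eq_add κ
    rw [hr₀]
    exact h4.trans_le le_add_self

/-! ### Functions with unbounded fibres -/

/-- A bijection with `K × κ.ord` splits the final stretch of `r` into `κ` fibres of size `κ`; a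
proper initial segment of `κ.ord` is too small to contain one. -/
theorem exists_unbounded_fibers {κ : Cardinal.{u}} (hκ : ℵ₀ ≤ κ) {K : Type u} (hK : #K = κ)
    {r r₀ : Ordinal.{u}} (hr : r = r₀ + κ.ord) :
    ∃ h : Ordinal.{u} → K, ∀ k, ∀ b < r, ∃ a < r, b ≤ a ∧ h a = k := by
  classical
  have hne : Nonempty K := by
    rw [← mk_ne_zero_iff, hK]
    exact (aleph0_pos.trans_le hκ).ne'
  obtain ⟨e⟩ : Nonempty (κ.ord.ToType ≃ K × κ.ord.ToType) := by
    rw [← Cardinal.eq, mk_prod, mk_toType, card_ord, Cardinal.lift_id, Cardinal.lift_id, hK,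
      mul_eq_self hκ]
  refine ⟨fun a => if ha : a - r₀ < κ.ord then (e (ToType.mk ⟨a - r₀, ha⟩)).1
    else Classical.arbitrary K, fun k b hb => ?_⟩
  by_contra! hcon
  have hκ0 : κ.ord ≠ 0 := by
    rw [Ne, ord_eq_zero]
    exact (aleph0_pos.trans_le hκ).ne'
  rw [hr, lt_add_iff hκ0] at hb
  obtain ⟨c, hc, hbc⟩ := hb
  obtain ⟨wc, rfl⟩ := exists_tp_eq hc
  have hlt : ∀ t, e.symm (k, t) < wc := by
    intro t
    rw [← tp_lt_tp]
    by_contra! hle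
    refine hcon (r₀ + tp (e.symm (k, t))) ?_ (hbc.trans (add_le_add_right hle _)) ?_
    · rw [hr]
      exact add_lt_add_right (tp_lt _) _
    · have h1 : r₀ + tp (e.symm (k, t)) - r₀ < κ.ord := by
        rw [Ordinal.add_sub_cancel]
        exact tp_lt _
      rw [dif_pos h1]
      have h2 : ToType.mk ⟨r₀ + tp (e.symm (k, t)) - r₀, h1⟩ = e.symm (k, t) := by
        apply tp_injective
        simp [tp]
      rw [h2, Equiv.apply_symm_apply]
  have hle : #κ.ord.ToType ≤ #(Iio wc) := by
    refine mk_le_of_injective (f := fun t => ⟨e.symm (k, t), hlt t⟩) fun s t hst => ?_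
    have := e.symm.injective (congrArg Subtype.val hst)
    exact (Prod.ext_iff.1 this).2
  exact (hle.trans_lt (Cardinal.mk_Iio_lt wc (by rw [mk_toType, card_ord, type_toType]))).false

/-- Sets of ordinals coding the subsets of a set of cardinality `κ`. -/
theorem exists_coding {κ : Cardinal.{u}} (hκ : ℵ₀ < κ) :
    ∃ (c : Option κ.out → Ordinal.{u}) (g : Ordinal.{u} → Ordinal.{u})
      (A : Set κ.out → Set Ordinal.{u}), Function.Injective c ∧
      (∀ k, ω₁ * ω ≤ c k) ∧
      (∀ T, ∀ a ∈ A T, g a < a ∧ a < rOrd κ ∧ (g a = c none ∨ ∃ t ∈ T, g a = c (some t))) ∧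
      (∀ T, ∀ b < rOrd κ, ∃ a ∈ {a | a ∈ A T ∧ g a = c none}, b ≤ a) ∧
      (∀ T, ∀ t ∈ T, ∀ b < rOrd κ, ∃ a ∈ {a | a ∈ A T ∧ g a = c (some t)}, b ≤ a) := by
  -- The spare index `none` is used for every `T`, so that planks are cofinal even when `T` is
  -- empty.
  have hK : #(Option κ.out) = κ := by
    rw [mk_option, mk_out, add_one_eq hκ.le]
  obtain ⟨e⟩ : Nonempty (Option κ.out ≃ κ.ord.ToType) := by
    rw [← Cardinal.eq, hK, mk_toType, card_ord]
  obtain ⟨r₀, hr₀⟩ := rOrd_eq_add κ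
  obtain ⟨h, hh⟩ := exists_unbounded_fibers hκ.le hK hr₀
  -- Codes start at `ω₁ * ω`, where the ranks of cuts are known exactly.
  let c : Option κ.out → Ordinal.{u} := fun k => ω₁ * ω + tp (e k)
  have hc : ∀ k, c k < rOrd κ := fun k => omega_one_mul_add_lt_rOrd hκ (tp_lt _)
  have hlim : Order.IsSuccLimit (rOrd κ) := by
    rw [hr₀]
    exact isSuccLimit_add _ (isSuccLimit_ord hκ.le)
  -- Since `rOrd κ` is a limit, discarding the exponents `a ≤ c k` leaves each fibre cofinal.
  have hcof : ∀ k, ∀ b < rOrd κ, ∃ a < rOrd κ, b ≤ a ∧ h a = k ∧ c k < a := by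
    intro k b hb
    obtain ⟨a, ha, hba, hk⟩ := hh k (max b (c k + 1)) (max_lt hb (hlim.add_one_lt (hc k)))
    exact ⟨a, ha, (le_max_left _ _).trans hba, hk,
      (lt_add_one _).trans_le ((le_max_right _ _).trans hba)⟩
  refine ⟨c, fun a => c (h a), fun T => {a | a < rOrd κ ∧ c (h a) < a ∧
    (h a = none ∨ ∃ t ∈ T, h a = some t)}, ?_, ?_, ?_, ?_, ?_⟩
  · exact fun k l hkl => e.injective (tp_injective (add_left_cancel hkl))
  · exact fun k => le_self_add
  · rintro T a ⟨h1, h2, h3⟩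
    exact ⟨h2, h1, h3.imp (congrArg c) fun ⟨t, ht, hat⟩ => ⟨t, ht, congrArg c hat⟩⟩
  · intro T b hb
    obtain ⟨a, ha, hba, hk, hca⟩ := hcof none b hb
    exact ⟨a, ⟨⟨ha, by rwa [hk], Or.inl hk⟩, congrArg c hk⟩, hba⟩
  · intro T t ht b hb
    obtain ⟨a, ha, hba, hk, hca⟩ := hcof (some t) b hb
    exact ⟨a, ⟨⟨ha, by rwa [hk], Or.inr ⟨t, ht, hk⟩⟩, congrArg c hk⟩, hba⟩

end NearlyOrdinal

/-! ### The family indexed by the subsets of `κ` -/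

theorem theorem3p1 (κ : Cardinal.{u}) (hκ : ℵ₀ < κ) :
    ∃ (ι : Type u) (P : ι → PartOrd.{u}),
      #ι = 2 ^ κ ∧
      (∀ a, IsUnionOfTwoWellOrders (P a)) ∧
      -- the nearly ordinal spaces `fs(P a)`
      (∀ a, IsUnitary (FinalSegments (P a)) ∧
        #(FinalSegments (P a)) = κ ∧
        cbRank (FinalSegments (P a)) = rOrd κ) ∧
      (∀ a, ¬ IsRetractive (FinalSegments (P a)) ∧
        ∀ e : FinalSegments (P a), IsEndPoint e →
          ∀ U ∈ 𝓝 e, ContainsTikhonovPlank U) ∧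
      (∀ a b, a ≠ b →
        ¬ AlmostHomeomorphic (FinalSegments (P a)) (FinalSegments (P b))) ∧
      -- the nearly ordinal algebras `F(P a)`
      ∃ (B : ι → BoolAlg.{u}) (i : ∀ a, P a ↪o B a),
        (∀ a, IsFreeBooleanAlgebra (i a)) ∧
        (∀ a, #(B a) = κ) ∧
        (∀ a b, a ≠ b → IsEmpty (B a ≃o B b)) := by
  obtain ⟨c, g, A, hcinj, hc, hA, hnone, hsome⟩ := exists_coding hκ
  have hr : ω₁ * ω ≤ rOrd κ := by
    have := omega_one_mul_add_lt_rOrd hκ (ζ := 0) (by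
      rw [← ord_zero, ord_lt_ord]
      exact aleph0_pos.trans hκ)
    rw [add_zero] at this
    exact this.le
  have hlim : Order.IsSuccLimit (rOrd κ) := by
    obtain ⟨r₀, hr₀⟩ := rOrd_eq_add κ
    rw [hr₀]
    exact isSuccLimit_add _ (isSuccLimit_ord hκ.le)
  have hcard : (ω ^ rOrd κ).card = κ := by
    rw [card_omega0_opow hlim.ne_bot, card_rOrd hκ, max_eq_right hκ.le]
  have hg : ∀ T, ∀ a ∈ A T, g a < a := fun T a ha => (hA T a ha).1
  have hlt : ∀ T, ∀ a ∈ A T, a < rOrd κ := fun T a ha => (hA T a ha).2.1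
  have hge : ∀ T, ∀ a ∈ A T, ω₁ * ω ≤ g a := fun T a ha => by
    rcases (hA T a ha).2.2 with h | ⟨t, -, h⟩ <;> rw [h] <;> exact hc _
  let Q : Set κ.out → Type u := fun T => BlowUp (ω ^ rOrd κ) (sparseSet (A T) g)
  have hmk : ∀ T, #(Q T) = κ := fun T => BlowUp.mk_eq hκ hcard
  have hinf : ∀ T, Infinite (Q T) := fun T => by
    rw [infinite_iff, hmk]
    exact hκ.le
  have hplank : ∀ T, ∀ e : FinalSegments (Q T), IsEndPoint e →
      ∀ U ∈ 𝓝 e, ContainsTikhonovPlank U := by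
    intro T e he U hU
    obtain rfl := BlowUp.eq_end_of_isEndPoint hr he
    refine BlowUp.containsTikhonovPlank_of_mem_nhds (hg T) (hlt T) hlim hU fun b hb => ?_
    obtain ⟨a, ha, hba⟩ := hnone T b hb
    exact ⟨a, ha.1, hba⟩
  have hsub : ∀ S T : Set κ.out, AlmostHomeomorphic (FinalSegments (Q S)) (FinalSegments (Q T)) →
      S ⊆ T ∧ T ⊆ S := by
    rintro S T ⟨x, y, hx, hy, U, V, hU, hV, hxU, hyV, ⟨φ⟩⟩
    obtain rfl := BlowUp.eq_end_of_isEndPoint hr hx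
    obtain rfl := BlowUp.eq_end_of_isEndPoint hr hy
    -- End-points are unique, so `U` and `V` are neighbourhoods of the two cuts at `ω ^ rOrd κ`.
    -- Their common set of ranks contains `c (some t) + 1` exactly when `t ∈ S`, and exactly when `t
    -- ∈ T`.
    have heq := plankLimitRanks_congr hU.isOpen hV.isOpen φ
    have key : ∀ T : Set κ.out, ∀ t, ∀ W : Set (FinalSegments (Q T)),
        c (some t) + 1 ∈ plankLimitRanks W → t ∈ T := by
      intro T t W ht
      obtain ⟨a, ha, hta⟩ := BlowUp.exists_of_mem_plankLimitRanks (hg T) (hlt T) (hge T) ht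
      have hta' : c (some t) = g a := by simpa using hta
      rcases (hA T a ha).2.2 with h | ⟨s, hs, h⟩
      · exact absurd (hcinj (hta'.trans h)) (by simp)
      · rwa [Option.some_injective _ (hcinj (hta'.trans h))]
    constructor
    · intro t ht
      have := BlowUp.mem_plankLimitRanks (hg S) (hlt S) (hge S) hlim (hU.isOpen.mem_nhds hxU)
        (hsome S t ht)
      rw [heq] at this
      exact key T t V this
    · intro t ht
      have := BlowUp.mem_plankLimitRanks (hg T) (hlt T) (hge T) hlim (hV.isOpen.mem_nhds hyV)
        (hsome T t ht)
      rw [← heq] at this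
      exact key S t U this
  have hnot : ∀ S T : Set κ.out, S ≠ T →
      ¬ AlmostHomeomorphic (FinalSegments (Q S)) (FinalSegments (Q T)) :=
    fun S T hne h => hne (Subset.antisymm (hsub S T h).1 (hsub S T h).2)
  refine ⟨Set κ.out, fun T => PartOrd.of (Q T), by rw [mk_set, mk_out],
    fun T => BlowUp.isUnionOfTwoWellOrders _ _,
    fun T => ⟨BlowUp.isUnitary hr, ?_, BlowUp.cbRank_eq hr⟩,
    fun T => ⟨?_, hplank T⟩, hnot, fun T => BoolAlg.of (freeAlg (Q T)),
    fun T => freeAlg.of (Q T), fun T => isFreeBooleanAlgebra_of, fun T => ?_, fun S T hne => ?_⟩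
  · exact (FinalSegments.mk_eq (BlowUp.isUnionOfTwoWellOrders _ _)).trans (hmk T)
  · obtain ⟨f, hf, -⟩ := hplank T _ (BlowUp.isEndPoint_end hr) Set.univ Filter.univ_mem
    exact TikhonovPlank.not_isRetractive hf
  · exact mk_freeAlg.trans (hmk T)
  · exact ⟨fun φ => hnot S T hne
      (almostHomeomorphic_of_homeomorph (BlowUp.isEndPoint_end hr) (freeAlg.homeomorph φ))⟩
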